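/- Let $\mathcal H$ be a separable complex Hilbert space, $d\ge 1$, and let $\mathcal F=\mathcal H\otimes\mathcal F_{\mathrm b}(L^2(\mathbb R^d))$, where for a $\sigma$-finite measure space $X$ the boson Fock space is $\mathcal F_{\mathrm b}(L^2(X))=\bigoplus_{n=0}^\infty\otimes_{\mathrm s}^nL^2(X)$ ($\otimes_{\mathrm s}^0L^2(X)=\mathbb C$). For an operator $T$ on $L^2(X)$ its second quantization is $d\Gamma_X(T)=\bigoplus_{n=0}^\infty T^{(n)}$, where $T^{(0)}=0$ and $T^{(n)}$ is the closure of $\sum_{j=1}^n I\otimes\cdots\otimes T\otimes\cdots\otimes I$ ($T$ in the $j$-th place) on $\otimes^n_{\mathrm s}L^2(X)$. Let $1$ denote multiplication by the constant function $1$, and let $N=I\otimes d\Gamma_{\mathbb R^d}(1)$ on $\mathcal F$. For $\varepsilon>0$ put $\mathbb R^d_{<\varepsilon}=\{k:|k|<\varepsilon\}$, $\mathbb R^d_{>\varepsilon}=\{k:|k|>\varepsilon\}$, and let $$U_\varepsilon:\mathcal F\to\mathcal H\otimes\mathcal F_{\mathrm b}(L^2(\mathbb R^d_{<\varepsilon}))\otimes\mathcal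 F_{\mathrm b}(L^2(\mathbb R^d_{>\varepsilon}))$$ be the canonical unitary operator, which sends $x\otimes a^\dagger(f_1)\cdots a^\dagger(f_m)a^\dagger(g_1)\cdots a^\dagger(g_n)\Omega$ to $x\otimes a^\dagger(f_1)\cdots a^\dagger(f_m)\Omega\otimes a^\dagger(g_1)\cdots a^\dagger(g_n)\Omega$ for $x\in\mathcal H$, $f_i\in L^2(\mathbb R^d_{<\varepsilon})$, $g_j\in L^2(\mathbb R^d_{>\varepsilon})$, where $\Omega$ denotes the respective Fock vacuum and $a^\dagger$ the creation operators. Let $N_{>\varepsilon}=U_\varepsilon^*\,(I\otimes I\otimes d\Gamma_{\mathbb R^d_{>\varepsilon}}(1))\,U_\varepsilon$ on $\mathcal F$. Write $N^{1/2}$ and $N_{>\varepsilon}^{1/2}$ for the non-negative self-adjoint square roots and $D(\cdot)$ for domains, and set $$D_{\mathrm{CNB}}=\Big\{\Psi\in\bigcap_{\varepsilon>0}D(N_{>\varepsilon}^{1/2})\ \Big|\ \sup_{\varepsilon>0}\|N_{>\varepsilon}^{1/2}\Psi\|_{\mathcal F}^2<\infty\Big\}.$$ Then $D_{\mathrm{CNB}}=D(N^{1/2})$,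 and $$\sup_{\varepsilon>0}\|N_{>\varepsilon}^{1/2}\Psi\|_{\mathcal F}^2=\|N^{1/2}\Psi\|_{\mathcal F}^2\qquad\text{for every }\Psi\in D_{\mathrm{CNB}}.$$ -/

import Mathlib

open MeasureTheory
open scoped TensorProduct InnerProductSpace

noncomputable section

namespace FockNumber

/-! ## Tensor products of Hilbert spaces and unbounded operators -/

/-- The Hilbert space tensor product: the completion of the algebraic tensor product with respect
to the inner product `⟪x ⊗ y, x' ⊗ y'⟫ = ⟪x, x'⟫ * ⟪y, y'⟫`. -/
abbrev HilbertTensor (E F : Type*) [NormedAddCommGroup E] [InnerProductSpace ℂ E]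
    [NormedAddCommGroup F] [InnerProductSpace ℂ F] : Type _ :=
  UniformSpace.Completion (E ⊗[ℂ] F)

/-- The elementary tensor `x ⊗ y` in the Hilbert space tensor product. -/
def elemTensor {E F : Type*} [NormedAddCommGroup E] [InnerProductSpace ℂ E]
    [NormedAddCommGroup F] [InnerProductSpace ℂ F] (x : E) (y : F) : HilbertTensor E F :=
  ((x ⊗ₜ[ℂ] y : E ⊗[ℂ] F) : UniformSpace.Completion (E ⊗[ℂ] F))

/-- The closed operator `I ⊗ A` from `E ⊗ F` to `E ⊗ G` for an operator `A` from `F` to `G`: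
the closure of the operator `x ⊗ y ↦ x ⊗ A y` on the algebraic tensor product `E ⊗ D(A)`. -/
def idTensor (E : Type*) {F G : Type*} [NormedAddCommGroup E] [InnerProductSpace ℂ E]
    [NormedAddCommGroup F] [InnerProductSpace ℂ F] [NormedAddCommGroup G] [InnerProductSpace ℂ G]
    (A : F →ₗ.[ℂ] G) : HilbertTensor E F →ₗ.[ℂ] HilbertTensor E G :=
  (Submodule.span ℂ {p : HilbertTensor E F × HilbertTensor E G |
    ∃ (x : E) (y : A.domain), p = (elemTensor x (y : F), elemTensor x (A y))}
    ).topologicalClosure.toLinearPMap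

/-- `B` is a non-negative self-adjoint operator with `B² = A`, where `B²` is the operator product
with its natural domain `{x ∈ D(B) | B x ∈ D(B)}`. -/
def IsNonnegSqrt {E : Type*} [NormedAddCommGroup E] [InnerProductSpace ℂ E] [CompleteSpace E]
    (A B : E →ₗ.[ℂ] E) : Prop :=
  IsSelfAdjoint B ∧ (∀ x : B.domain, 0 ≤ (⟪(x : E), B x⟫_ℂ).re) ∧
    ∀ x z : E, (x, z) ∈ A.graph ↔ ∃ y : E, (x, y) ∈ B.graph ∧ (y, z) ∈ B.graph

/-- The square root `A^{1/2}` of a non-negative self-adjoint operator `A`: its unique non-negative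
self-adjoint square root. -/
def opSqrt {E : Type*} [NormedAddCommGroup E] [InnerProductSpace ℂ E] [CompleteSpace E]
    (A : E →ₗ.[ℂ] E) : E →ₗ.[ℂ] E :=
  Classical.epsilon (IsNonnegSqrt A)

/-- The operator `U* A U`, with domain `{x ∈ D(U) | U x ∈ D(A), A (U x) ∈ Ran U}` (which is
`{x | U x ∈ D(A)}` for unitary `U`). -/
def conjBy {E F : Type*} [NormedAddCommGroup E] [InnerProductSpace ℂ E]
    [NormedAddCommGroup F] [InnerProductSpace ℂ F] (U : E →ₗ.[ℂ] F) (A : F →ₗ.[ℂ] F) :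
    E →ₗ.[ℂ] E :=
  Submodule.toLinearPMap
    { carrier := {p | ∃ q ∈ A.graph, (p.1, q.1) ∈ U.graph ∧ (p.2, q.2) ∈ U.graph}
      zero_mem' := ⟨0, A.graph.zero_mem, U.graph.zero_mem, U.graph.zero_mem⟩
      add_mem' := by
        rintro p p' ⟨q, hq, h1, h2⟩ ⟨q', hq', h1', h2'⟩
        exact ⟨q + q', A.graph.add_mem hq hq', U.graph.add_mem h1 h1', U.graph.add_mem h2 h2'⟩
      smul_mem' := by
        rintro c p ⟨q, hq, h1, h2⟩
        exact ⟨c • q, A.graph.smul_mem c hq, U.graph.smul_mem c h1, U.graph.smul_mem c h2⟩ }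

/-! ## The boson Fock space over `L²(X, μ)` -/

section Fock

variable {X : Type*} [MeasurableSpace X]

/-- `L²(X, μ)`, complex-valued. -/
abbrev L2 (μ : Measure X) : Type _ := Lp ℂ 2 μ

/-- `L²(Xⁿ, μⁿ)`, i.e. the `n`-fold Hilbert space tensor power of `L²(X, μ)`.  For `n = 0` the
space `X⁰` is one point of mass one, so this is `ℂ`. -/
abbrev L2Pow (μ : Measure X) (n : ℕ) : Type _ := Lp ℂ 2 (Measure.pi fun _ : Fin n => μ)

variable (μ : Measure X) [SigmaFinite μ]

lemma measurePreserving_perm {n : ℕ} (σ : Equiv.Perm (Fin n)) :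
    MeasurePreserving (fun (x : Fin n → X) (i : Fin n) => x (σ i))
      (Measure.pi fun _ : Fin n => μ) (Measure.pi fun _ : Fin n => μ) := by
  have h := measurePreserving_piCongrLeft (fun _ : Fin n => μ) σ.symm
  convert h using 1
  ext x i
  have := MeasurableEquiv.piCongrLeft_apply_apply (β := fun _ : Fin n => X) σ.symm x (σ i)
  simpa using this.symm

/-- The action of permutations on `L²(Xⁿ)`: `(permute σ ψ)(k₁, …, kₙ) = ψ(k_{σ 1}, …, k_{σ n})`. -/
def permute {n : ℕ} (σ : Equiv.Perm (Fin n)) (ψ : L2Pow μ n) : L2Pow μ n :=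
  Lp.compMeasurePreserving _ (measurePreserving_perm μ σ) ψ

/-- The `n`-fold symmetric tensor product of `L²(X, μ)`, as the space of permutation invariant
elements of `L²(Xⁿ, μⁿ)`. -/
def symPow (n : ℕ) : Submodule ℂ (L2Pow μ n) where
  carrier := {ψ | ∀ σ : Equiv.Perm (Fin n), permute μ σ ψ = ψ}
  zero_mem' := fun σ => map_zero _
  add_mem' := by
    intro ψ φ hψ hφ σ
    exact (map_add _ ψ φ).trans (congrArg₂ (· + ·) (hψ σ) (hφ σ))
  smul_mem' := by
    intro c ψ hψ σ
    exact (map_smul (Lp.compMeasurePreservingₗ ℂ _ (measurePreserving_perm μ σ)) c ψ).trans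
      (congrArg (c • ·) (hψ σ))

variable {μ}

lemma memLp_tensor {n : ℕ} (f : Fin n → L2 μ) :
    MemLp (fun x : Fin n → X => ∏ i, f i (x i)) 2 (Measure.pi fun _ : Fin n => μ) := by
  have hm : AEStronglyMeasurable (fun x : Fin n → X => ∏ i, f i (x i))
      (Measure.pi fun _ : Fin n => μ) := by
    refine Finset.aestronglyMeasurable_fun_prod _ fun i _ => ?_
    exact (Lp.aestronglyMeasurable (f i)).comp_quasiMeasurePreserving
      (Measure.quasiMeasurePreserving_eval _ i)
  rw [memLp_two_iff_integrable_sq_norm hm]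
  have h : Integrable (fun x : Fin n → X => ∏ i, ‖f i (x i)‖ ^ 2)
      (Measure.pi fun _ : Fin n => μ) :=
    Integrable.fintype_prod (f := fun i x => ‖f i x‖ ^ 2)
      fun i => (memLp_two_iff_integrable_sq_norm (Lp.aestronglyMeasurable (f i))).1 (Lp.memLp (f i))
  simpa only [norm_prod, Finset.prod_pow] using h

/-- The tensor `f₁ ⊗ ⋯ ⊗ fₙ`, i.e. the function `(k₁, …, kₙ) ↦ f₁(k₁) ⋯ fₙ(kₙ)`. -/
def tensor {n : ℕ} (f : Fin n → L2 μ) : L2Pow μ n :=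
  (memLp_tensor f).toLp _

lemma permute_tensor {n : ℕ} (σ : Equiv.Perm (Fin n)) (f : Fin n → L2 μ) :
    permute μ σ (tensor f) = tensor fun i => f (σ.symm i) := by
  unfold permute tensor
  rw [Lp.toLp_compMeasurePreserving]
  congr 1
  funext x
  exact Fintype.prod_equiv σ _ _ fun i => by simp

/-- The symmetric tensor `√(n!) Sₙ(f₁ ⊗ ⋯ ⊗ fₙ)`, where `Sₙ` is the symmetrization projection
`(1 / n!) ∑_σ σ`.  In Fock space this is the vector `a†(f₁) ⋯ a†(fₙ) Ω`. -/
def symTensor {n : ℕ} (f : Fin n → L2 μ) : symPow μ n :=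
  ⟨((Real.sqrt (n.factorial : ℝ) : ℂ)⁻¹) • ∑ τ : Equiv.Perm (Fin n), tensor fun i => f (τ i), by
    intro σ
    have hs : ∀ ψ : L2Pow μ n, permute μ σ ψ =
      Lp.compMeasurePreservingₗ ℂ _ (measurePreserving_perm μ σ) ψ := fun _ => rfl
    rw [hs, map_smul, map_sum]
    simp only [← hs, permute_tensor]
    congr 1
    exact Fintype.sum_equiv (Equiv.mulRight σ.symm) _ _ fun τ => rfl⟩

variable (μ) in
/-- The boson Fock space over `L²(X, μ)`: the Hilbert space direct sum of the symmetric tensor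
powers. -/
abbrev Fock : Type _ := lp (fun n : ℕ => symPow μ n) 2

/-- The vector of the Fock space whose only component is `symTensor f`, in the `n`-particle space;
for `n = 0` it is the Fock vacuum. -/
def fockVec {n : ℕ} (f : Fin n → L2 μ) : Fock μ :=
  lp.single 2 n (symTensor f)

/-- The operator `T⁽ⁿ⁾` on the `n`-fold symmetric tensor product: the closure of
`∑ⱼ I ⊗ ⋯ ⊗ T ⊗ ⋯ ⊗ I` (with `T` in the `j`-th place).  For `n = 0` it is `0`. -/
def dGammaN (T : L2 μ →ₗ.[ℂ] L2 μ) (n : ℕ) : symPow μ n →ₗ.[ℂ] symPow μ n :=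
  (Submodule.span ℂ {p : symPow μ n × symPow μ n | ∃ f : Fin n → T.domain,
    p = (symTensor fun i => (f i : L2 μ),
      ∑ j, symTensor (Function.update (fun i => (f i : L2 μ)) j (T (f j))))}
    ).topologicalClosure.toLinearPMap

/-- The second quantization `dΓ(T) = ⨁ₙ T⁽ⁿ⁾`: its domain consists of all `ψ` such that
`ψ⁽ⁿ⁾ ∈ D(T⁽ⁿ⁾)` for all `n` and `∑ₙ ‖T⁽ⁿ⁾ ψ⁽ⁿ⁾‖² < ∞`. -/
def dGamma (T : L2 μ →ₗ.[ℂ] L2 μ) : Fock μ →ₗ.[ℂ] Fock μ :=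
  Submodule.toLinearPMap
    { carrier := {p | ∀ n, (p.1 n, p.2 n) ∈ (dGammaN T n).graph}
      zero_mem' := fun n => (dGammaN T n).graph.zero_mem
      add_mem' := fun h h' n => (dGammaN T n).graph.add_mem (h n) (h' n)
      smul_mem' := fun c _ h n => (dGammaN T n).graph.smul_mem c (h n) }

variable (μ) in
/-- The operator of multiplication by the constant function `1` on `L²(X, μ)`. -/
def mulOne : L2 μ →ₗ.[ℂ] L2 μ := (LinearMap.id : L2 μ →ₗ[ℂ] L2 μ).toPMap ⊤

variable (μ) in
/-- The number operator `dΓ(1)` on the Fock space over `L²(X, μ)`. -/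
def fockNumber : Fock μ →ₗ.[ℂ] Fock μ := dGamma (mulOne μ)

variable (μ) in
/-- For disjoint sets `s` and `t` whose union has full measure, the canonical unitary operator
from the Fock space over `L²(X)` onto the tensor product of the Fock spaces over `L²(s)` and
`L²(t)`.  It is the closed linear operator with
`a†(f₁) ⋯ a†(fₘ) a†(g₁) ⋯ a†(gₙ) Ω ↦ (a†(f₁) ⋯ a†(fₘ) Ω) ⊗ (a†(g₁) ⋯ a†(gₙ) Ω)`
for all `f₁, …, fₘ` vanishing a.e. outside `s` and all `g₁, …, gₙ` vanishing a.e. outside `t`. -/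
def fockSplit (s t : Set X) :
    Fock μ →ₗ.[ℂ] HilbertTensor (Fock (μ.restrict s)) (Fock (μ.restrict t)) :=
  (Submodule.span ℂ {p : Fock μ × HilbertTensor (Fock (μ.restrict s)) (Fock (μ.restrict t)) |
    ∃ (m n : ℕ) (f : Fin m → L2 μ) (g : Fin n → L2 μ),
      (∀ i, ∀ᵐ k ∂μ, k ∉ s → f i k = 0) ∧ (∀ j, ∀ᵐ k ∂μ, k ∉ t → g j k = 0) ∧
      p = (fockVec (Fin.append f g),
        elemTensor (fockVec fun i => LpToLpRestrictCLM X ℂ ℂ μ 2 s (f i))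
          (fockVec fun j => LpToLpRestrictCLM X ℂ ℂ μ 2 t (g j)))}
    ).topologicalClosure.toLinearPMap

end Fock

/-! ## Number operators on `𝓗 ⊗ 𝓕_b(L²(ℝᵈ))` -/

section Number

variable (H : Type*) [NormedAddCommGroup H] [InnerProductSpace ℂ H] (d : ℕ)

/-- Lebesgue measure on `ℝᵈ`. -/
abbrev leb : Measure (EuclideanSpace ℝ (Fin d)) := volume

/-- The set of `k` in `ℝᵈ` with `|k| < ε`. -/
def inner_set (ε : ℝ) : Set (EuclideanSpace ℝ (Fin d)) := {k | ‖k‖ < ε}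

/-- The set of `k` in `ℝᵈ` with `|k| > ε`. -/
def outer_set (ε : ℝ) : Set (EuclideanSpace ℝ (Fin d)) := {k | ε < ‖k‖}

/-- The total state space `𝓕 = 𝓗 ⊗ 𝓕_b(L²(ℝᵈ))`. -/
abbrev StateSpace : Type _ := HilbertTensor H (Fock (leb d))

/-- The space `𝓕_ε = 𝓗 ⊗ 𝓕_b(L²(|k| < ε)) ⊗ 𝓕_b(L²(|k| > ε))`. -/
abbrev SplitSpace (ε : ℝ) : Type _ :=
  HilbertTensor H (HilbertTensor (Fock ((leb d).restrict (inner_set d ε)))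
    (Fock ((leb d).restrict (outer_set d ε))))

/-- The canonical unitary operator `U_ε : 𝓕 → 𝓕_ε`. -/
def splitOp (ε : ℝ) : StateSpace H d →ₗ.[ℂ] SplitSpace H d ε :=
  idTensor H (fockSplit (leb d) (inner_set d ε) (outer_set d ε))

/-- The boson number operator `N = I ⊗ dΓ(1)` on `𝓕`. -/
def number : StateSpace H d →ₗ.[ℂ] StateSpace H d :=
  idTensor H (fockNumber (leb d))

/-- The operator `N_{>ε} = U_ε* (I ⊗ I ⊗ dΓ_{>ε}(1)) U_ε` on `𝓕`. -/
def numberGT (ε : ℝ) : StateSpace H d →ₗ.[ℂ] StateSpace H d :=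
  conjBy (splitOp H d ε)
    (idTensor H (idTensor (Fock ((leb d).restrict (inner_set d ε)))
      (fockNumber ((leb d).restrict (outer_set d ε)))))

/-- `D_CNB`: the vectors `Ψ` in `⋂_{ε > 0} D(N_{>ε}^{1/2})` such that
`sup_{ε > 0} ‖N_{>ε}^{1/2} Ψ‖² < ∞`. -/
def domainCNB : Set (StateSpace H d) :=
  {Ψ | ∃ h : ∀ ε : ℝ, 0 < ε → Ψ ∈ (opSqrt (numberGT H d ε)).domain,
    BddAbove (Set.range fun ε : Set.Ioi (0 : ℝ) =>
      ‖opSqrt (numberGT H d ε) ⟨Ψ, h ε ε.2⟩‖ ^ 2)}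

end Number

end FockNumber

end

/-! Both number operators are diagonal: each acts as multiplication by `n` on the range of the
`n`-th member of a resolution of the identity. Write `P n` for the projections of `N` and `Q n` for
those of `N_{>ε}`. A non-negative diagonal operator has exactly one non-negative self-adjoint square
root, which multiplies by `√n` (`isDiag_opSqrt`). So `‖N^{1/2} Ψ‖²` is the sum of `n ‖P n Ψ‖²`, an
element of `[0, ∞]` that is finite exactly on the domain, and likewise for `N_{>ε}`. The theorem
becomes an identity between such forms (`iSup_numberForm`).

The vectors `x ⊗ a†(f₁)⋯a†(fₘ) a†(g₁)⋯a†(gₙ) Ω`, with the `f`'s supported in `|k| < ε` and the `g`'s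
in `|k| > ε`, are total because the sphere `|k| = ε` is null. On them `N` has eigenvalue `m + n` and
`N_{>ε}` has eigenvalue `n ≤ m + n`. Hence the two families of projections commute and `Q n P m = 0`
for `n > m`, which gives form(`N_{>ε}`) ≤ form(`N`).

For the opposite inequality, vectors whose one-particle factors vanish near `0` are total because
`{0}` is null. For small `ε` all particles of such a vector lie in `|k| > ε`, so `Q n P n → P n`
strongly as `ε → 0`. Discarding all but the terms `n ‖Q n P n Ψ‖²` and passing to the limit in
finite partial sums bounds form(`N`) by the supremum.

The operators are defined as closures of relations on product vectors, so their diagonal form must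
be proved. For `U_ε` this rests on inner products of symmetric tensors being permanents: disjoint
supports make the matrix block diagonal and the permanent factors (`sum_equiv_prod_block`). Only the
isometry of `U_ε` enters, not its surjectivity. -/

noncomputable section

namespace FockNumber

open Filter Topology Submodule

/-! ### Total sets and isometries generated by relations -/

section Abstract

variable {E F : Type*} [NormedAddCommGroup E] [InnerProductSpace ℂ E]
  [NormedAddCommGroup F] [InnerProductSpace ℂ F]

/-- A set whose linear span is dense. -/
def IsTotal (S : Set E) : Prop := (span ℂ S).topologicalClosure = ⊤

lemma IsTotal.le_of_subset {S : Set E} (hS : IsTotal S) {K : Submodule ℂ E}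
    (hK : IsClosed (K : Set E)) (h : S ⊆ K) (x : E) : x ∈ K :=
  topologicalClosure_minimal _ (span_le.2 h) hK (hS ▸ mem_top)

lemma isTotal_iff {S : Set E} :
    IsTotal S ↔ ∀ K : Submodule ℂ E, IsClosed (K : Set E) → S ⊆ K → ∀ x, x ∈ K :=
  ⟨fun h _ hK hSK x => h.le_of_subset hK hSK x, fun h => eq_top_iff.2 fun x _ =>
    h _ (isClosed_topologicalClosure _) (subset_span.trans (le_topologicalClosure _)) x⟩

lemma IsTotal.ext {S : Set E} (hS : IsTotal S) {A B : E →L[ℂ] F}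
    (h : ∀ s ∈ S, A s = B s) (x : E) : A x = B x :=
  hS.le_of_subset (K := LinearMap.eqLocus (A : E →ₗ[ℂ] F) (B : E →ₗ[ℂ] F))
    (isClosed_eq A.continuous B.continuous) h x

lemma IsTotal.inner_symm {S : Set E} (hS : IsTotal S) {A : E →L[ℂ] E}
    (h : ∀ s ∈ S, ∀ t ∈ S, ⟪A s, t⟫_ℂ = ⟪s, A t⟫_ℂ) (x y : E) :
    ⟪A x, y⟫_ℂ = ⟪x, A y⟫_ℂ := by
  have h1 : ∀ s ∈ S, ∀ y, ⟪A s, y⟫_ℂ = ⟪s, A y⟫_ℂ := fun s hs y =>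
    hS.ext (A := innerSL ℂ (A s)) (B := (innerSL ℂ s).comp A) (fun t ht => h s hs t ht) y
  have h2 : ⟪y, A x⟫_ℂ = ⟪A y, x⟫_ℂ :=
    hS.ext (A := (innerSL ℂ y).comp A) (B := innerSL ℂ (A y)) (fun s hs => by
      have := congrArg (starRingEnd ℂ) (h1 s hs y)
      rw [inner_conj_symm, inner_conj_symm] at this
      exact this) x
  have := congrArg (starRingEnd ℂ) h2
  simpa only [inner_conj_symm] using this

/-- For uniformly bounded operators the vectors on which strong convergence holds form a closed
subspace, by an `ε / 3` argument. -/
lemma IsTotal.tendsto {S : Set E} (hS : IsTotal S) {ι : Type*} {l : Filter ι}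
    {T : ι → E →L[ℂ] F} {T₀ : E →L[ℂ] F} (hT : ∀ i x, ‖T i x‖ ≤ ‖x‖)
    (hT₀ : ∀ x, ‖T₀ x‖ ≤ ‖x‖) (h : ∀ s ∈ S, Tendsto (fun i => T i s) l (𝓝 (T₀ s))) (x : E) :
    Tendsto (fun i => T i x) l (𝓝 (T₀ x)) := by
  let K : Submodule ℂ E :=
    { carrier := {x | Tendsto (fun i => T i x) l (𝓝 (T₀ x))}
      zero_mem' := by simpa using tendsto_const_nhds
      add_mem' := fun {a b} ha hb => by simpa using Tendsto.add ha hb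
      smul_mem' := fun c a ha => by simpa using Tendsto.const_smul ha c }
  refine hS.le_of_subset (K := K) ?_ h x
  refine isClosed_of_closure_subset fun x hx => ?_
  change Tendsto (fun i => T i x) l (𝓝 (T₀ x))
  rw [Metric.tendsto_nhds]
  intro ε hε
  obtain ⟨y, hy, hxy⟩ := Metric.mem_closure_iff.1 hx (ε / 3) (by positivity)
  have hy' : Tendsto (fun i => T i y) l (𝓝 (T₀ y)) := hy
  filter_upwards [Metric.tendsto_nhds.1 hy' (ε / 3) (by positivity)] with i hi
  rw [dist_eq_norm] at *
  have e : T i x - T₀ x = T i (x - y) + (T i y - T₀ y) - T₀ (x - y) := by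
    simp only [map_sub]; abel
  rw [e]
  linarith [norm_sub_le (T i (x - y) + (T i y - T₀ y)) (T₀ (x - y)),
    norm_add_le (T i (x - y)) (T i y - T₀ y), hT i (x - y), hT₀ (x - y)]

/-- A relation preserving inner products, with total domain, generates an isometry. -/
lemma exists_isometry_of_gram [CompleteSpace F] (S : Set (E × F))
    (hg : ∀ p ∈ S, ∀ q ∈ S, ⟪p.1, q.1⟫_ℂ = ⟪p.2, q.2⟫_ℂ) (ht : IsTotal (Prod.fst '' S)) :
    ∃ U : E →ₗᵢ[ℂ] F, (∀ x y,
      (x, y) ∈ (span ℂ S).topologicalClosure.toLinearPMap.graph ↔ U x = y) ∧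
      ∀ p ∈ S, U p.1 = p.2 := by
  have h1 : ∀ p ∈ span ℂ S, ∀ q ∈ span ℂ S, ⟪p.1, q.1⟫_ℂ = ⟪p.2, q.2⟫_ℂ := by
    intro p hp q hq
    induction hp using span_induction with
    | mem p hp =>
      induction hq using span_induction with
      | mem q hq => exact hg p hp q hq
      | zero => simp
      | add a b _ _ ha hb => simp [ha, hb]
      | smul c a _ ha => simp [ha]
    | zero => simp
    | add a b _ _ ha hb => simp [ha, hb]
    | smul c a _ ha => simp [ha]
  -- Equality of norms is a closed condition, so it survives the closure and makes the closed
  -- relation single-valued.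
  have h2 : ∀ p ∈ (span ℂ S).topologicalClosure, ‖p.1‖ = ‖p.2‖ := by
    intro p hp
    have hc : IsClosed {p : E × F | ‖p.1‖ = ‖p.2‖} :=
      isClosed_eq (by fun_prop) (by fun_prop)
    refine closure_minimal (fun q hq => ?_) hc hp
    have := h1 q hq q hq
    rw [inner_self_eq_norm_sq_to_K, inner_self_eq_norm_sq_to_K] at this
    have h : ‖q.1‖ ^ 2 = ‖q.2‖ ^ 2 := by exact_mod_cast this
    exact (sq_eq_sq₀ (norm_nonneg _) (norm_nonneg _)).1 h
  set G := (span ℂ S).topologicalClosure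
  have hG : ∀ p ∈ G, p.1 = 0 → p.2 = 0 := fun p hp h0 => by
    rw [← norm_eq_zero, ← h2 p hp, h0, norm_zero]
  -- The second components along an approximating sequence are Cauchy because the relation is
  -- isometric; completeness of `F` supplies the limit.
  have hdom : ∀ x : E, ∃ y, (x, y) ∈ G := by
    intro x
    have hx : x ∈ closure ((span ℂ (Prod.fst '' S) : Submodule ℂ E) : Set E) :=
      ht.le_of_subset (isClosed_topologicalClosure _)
        (subset_span.trans (le_topologicalClosure _)) x
    obtain ⟨u, hu, hux⟩ := mem_closure_iff_seq_limit.1 hx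
    have : ∀ n, ∃ y, (u n, y) ∈ span ℂ S := by
      intro n
      have hn := hu n
      have e : span ℂ (Prod.fst '' S) = (span ℂ S).map (LinearMap.fst ℂ E F) :=
        (map_span (LinearMap.fst ℂ E F) S).symm
      rw [e] at hn
      obtain ⟨p, hp, hpu⟩ := hn
      exact ⟨p.2, by rw [← hpu]; exact hp⟩
    choose v hv using this
    have hc : CauchySeq v := by
      have hcu := hux.cauchySeq
      rw [Metric.cauchySeq_iff] at hcu ⊢
      intro ε hε
      obtain ⟨N, hN⟩ := hcu ε hε
      refine ⟨N, fun m hm n hn => ?_⟩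
      have := h2 _ (le_topologicalClosure _ (sub_mem (hv m) (hv n)))
      simp only [Prod.fst_sub, Prod.snd_sub] at this
      rw [dist_eq_norm, ← this, ← dist_eq_norm]
      exact hN m hm n hn
    obtain ⟨y, hy⟩ := cauchySeq_tendsto_of_complete hc
    exact ⟨y, mem_closure_iff_seq_limit.2 ⟨fun n => (u n, v n), hv, hux.prodMk_nhds hy⟩⟩
  have hgr : G.toLinearPMap.graph = G := toLinearPMap_graph_eq G hG
  choose f hf using hdom
  have huniq : ∀ x y, (x, y) ∈ G → f x = y := fun x y h => by
    have := hG _ (G.sub_mem (hf x) h) (by simp)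
    exact sub_eq_zero.1 this
  refine ⟨{ toFun := f
            map_add' := fun x y => huniq _ _ (G.add_mem (hf x) (hf y))
            map_smul' := fun c x => huniq _ _ (G.smul_mem c (hf x))
            norm_map' := fun x => (h2 _ (hf x)).symm }, fun x y => ?_,
    fun p hp => huniq _ _ (le_topologicalClosure _ (subset_span hp))⟩
  rw [hgr]
  exact ⟨huniq x y, fun h => h ▸ hf x⟩

/-! ### Resolutions of the identity -/

/-- A sequence of mutually orthogonal projections summing to the identity. -/
structure IsResolution (P : ℕ → E →L[ℂ] E) : Prop where
  inner_symm : ∀ n x y, ⟪P n x, y⟫_ℂ = ⟪x, P n y⟫_ℂ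
  total : IsTotal {x : E | ∃ m, ∀ n, P n x = if n = m then x else 0}

lemma IsResolution.of_total {P : ℕ → E →L[ℂ] E} (hs : ∀ n x y, ⟪P n x, y⟫_ℂ = ⟪x, P n y⟫_ℂ)
    {S : Set E} (hS : IsTotal S) (h : ∀ s ∈ S, ∃ m, ∀ n, P n s = if n = m then s else 0) :
    IsResolution P :=
  ⟨hs, isTotal_iff.2 fun _ hK hSK => hS.le_of_subset hK fun s hs => hSK (h s hs)⟩

namespace IsResolution

variable {P : ℕ → E →L[ℂ] E} (hP : IsResolution P)
include hP

/-- Idempotence and mutual orthogonality are not fields of the structure; they follow by comparing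
both sides on the total set of joint eigenvectors. -/
lemma apply_apply (m n : ℕ) (x : E) : P m (P n x) = if m = n then P n x else 0 := by
  have := hP.total.ext (A := (P m).comp (P n)) (B := if m = n then P n else 0) (by
    rintro s ⟨k, hk⟩
    by_cases h : n = k <;> by_cases h' : m = n <;> simp_all) x
  rw [ContinuousLinearMap.comp_apply] at this
  rw [this]; split_ifs <;> simp

lemma apply_self (n : ℕ) (x : E) : P n (P n x) = P n x := by simp [hP.apply_apply]

/-- A finite partial sum `T` is a symmetric idempotent, so `‖T x‖² = ⟪x, T x⟫` and Cauchy–Schwarz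
gives a contraction. -/
lemma norm_sum_le (s : Finset ℕ) (x : E) : ‖(∑ n ∈ s, P n) x‖ ≤ ‖x‖ := by
  set T := ∑ n ∈ s, P n with hT
  have h1 : ⟪T x, T x⟫_ℂ = ⟪x, T x⟫_ℂ := by
    simp only [hT, sum_apply, sum_inner, inner_sum]
    rw [Finset.sum_comm]
    refine Finset.sum_congr rfl fun n hn => ?_
    rw [Finset.sum_eq_single n]
    · rw [hP.inner_symm, hP.apply_self]
    · intro m _ hm
      rw [hP.inner_symm, hP.apply_apply, if_neg hm.symm, inner_zero_right]
    · exact fun h => absurd hn h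
  have h2 : ‖T x‖ ^ 2 ≤ ‖x‖ * ‖T x‖ := by
    have := norm_inner_le_norm (𝕜 := ℂ) x (T x)
    rwa [← h1, ← inner_self_re_eq_norm (𝕜 := ℂ), inner_self_eq_norm_sq] at this
  by_contra! hlt
  nlinarith [norm_nonneg x, norm_nonneg (T x)]

lemma norm_le (n : ℕ) (x : E) : ‖P n x‖ ≤ ‖x‖ := by
  simpa using hP.norm_sum_le {n} x

/-- The partial sums are contractions and are eventually constant on the total set, so they converge
everywhere. -/
lemma hasSum (x : E) : HasSum (fun n => P n x) x := by
  have := hP.total.tendsto (T := fun s : Finset ℕ => ∑ n ∈ s, P n)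
    (T₀ := ContinuousLinearMap.id ℂ E) (l := atTop) hP.norm_sum_le (fun x => le_rfl) (by
      rintro x ⟨m, hm⟩
      have h : HasSum (fun n => P n x) (P m x) := hasSum_single m fun n hn => by simp [hm, hn]
      have e : P m x = x := by simp [hm]
      rw [e] at h
      simpa only [HasSum, SummationFilter.unconditional_filter, sum_apply,
    ContinuousLinearMap.id_apply] using h) x
  simpa only [HasSum, SummationFilter.unconditional_filter, sum_apply,
    ContinuousLinearMap.id_apply] using this

lemma ext {x y : E} (h : ∀ n, P n x = P n y) : x = y :=
  (hP.hasSum x).unique (by simpa only [h] using hP.hasSum y)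

lemma hasSum_inner (x y : E) : HasSum (fun n => ⟪P n x, P n y⟫_ℂ) ⟪x, y⟫_ℂ := by
  have := (innerSL ℂ x).hasSum (hP.hasSum y)
  simp only [innerSL_apply_apply] at this
  refine this.congr_fun fun n => ?_
  rw [hP.inner_symm, hP.apply_self]

lemma hasSum_norm_sq (x : E) : HasSum (fun n => ‖P n x‖ ^ 2) (‖x‖ ^ 2) := by
  have := Complex.reCLM.hasSum (hP.hasSum_inner x x)
  simpa only [Complex.reCLM_apply, ← RCLike.re_eq_complex_re, inner_self_eq_norm_sq] using this

lemma tsum_enorm_sq (x : E) : ∑' n, ‖P n x‖ₑ ^ 2 = ‖x‖ₑ ^ 2 := by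
  have h := hP.hasSum_norm_sq x
  have := ENNReal.ofReal_tsum_of_nonneg (fun n => sq_nonneg ‖P n x‖) h.summable
  rw [h.tsum_eq] at this
  simpa only [ENNReal.ofReal_pow (norm_nonneg _), ofReal_norm] using this.symm

lemma exists_of_summable [CompleteSpace E] {z : ℕ → E} (hz : ∀ n, P n (z n) = z n)
    (hs : Summable fun n => ‖z n‖ ^ 2) : ∃ y, ∀ n, P n y = z n := by
  have hz' : ∀ m n, P m (z n) = if m = n then z n else 0 := fun m n => by
    rw [← hz n, hP.apply_apply]
  have hV : OrthogonalFamily ℂ (fun n => LinearMap.range (P n : E →ₗ[ℂ] E))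
      fun n => (LinearMap.range (P n : E →ₗ[ℂ] E)).subtypeₗᵢ := by
    rintro m n hmn ⟨_, x, rfl⟩ ⟨_, y, rfl⟩
    change ⟪P m x, P n y⟫_ℂ = 0
    rw [hP.inner_symm, hP.apply_apply, if_neg hmn, inner_zero_right]
  have := (hV.summable_iff_norm_sq_summable fun n => ⟨z n, z n, hz n⟩).2 hs
  have h2 : Summable z := this
  refine ⟨∑' n, z n, fun m => ?_⟩
  rw [(P m).map_tsum h2, tsum_eq_single m fun n hn => by simp [hz', hn.symm]]
  exact hz m

end IsResolution

/-! ### Diagonal operators and their square roots -/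

/-- `A` is the operator acting as multiplication by `a n` on the range of `P n`, with its maximal
domain. -/
def IsDiag (A : E →ₗ.[ℂ] E) (P : ℕ → E →L[ℂ] E) (a : ℕ → ℝ) : Prop :=
  ∀ x y, (x, y) ∈ A.graph ↔ ∀ n, P n y = (a n : ℂ) • P n x

/-- The maximal graph of the operator acting as multiplication by `a n` on the range of `P n`. -/
def diagGraph (P : ℕ → E →L[ℂ] E) (a : ℕ → ℝ) : Submodule ℂ (E × E) where
  carrier := {p | ∀ n, P n p.2 = (a n : ℂ) • P n p.1}
  zero_mem' := fun n => by simp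
  add_mem' := fun h h' n => by simp [h n, h' n]
  smul_mem' := fun c p h n => by simp [h n, smul_comm c]

lemma isClosed_diagGraph (P : ℕ → E →L[ℂ] E) (a : ℕ → ℝ) :
    IsClosed (diagGraph P a : Set (E × E)) := by
  have : (diagGraph P a : Set (E × E)) = ⋂ n, {p | P n p.2 = (a n : ℂ) • P n p.1} := by
    ext p; simp [diagGraph]
  rw [this]
  exact isClosed_iInter fun n => isClosed_eq (by fun_prop) (by fun_prop)

lemma mem_graph_unique {A : E →ₗ.[ℂ] F} {x : E} {y z : F} (h : (x, y) ∈ A.graph)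
    (h' : (x, z) ∈ A.graph) : y = z := by
  have := A.graph_fst_eq_zero_snd (A.graph.sub_mem h h') (by simp)
  exact sub_eq_zero.1 this

namespace IsResolution

variable {P : ℕ → E →L[ℂ] E} (hP : IsResolution P)
include hP

lemma isDiag_of_graph {A : E →ₗ.[ℂ] E} {G : Submodule ℂ (E × E)} {a : ℕ → ℝ}
    (hA : A = G.toLinearPMap) (hG : ∀ x y, (x, y) ∈ G ↔ ∀ n, P n y = (a n : ℂ) • P n x) :
    IsDiag A P a := by
  intro x y
  rw [hA, toLinearPMap_graph_eq, hG]
  rintro ⟨u, v⟩ h h0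
  refine hP.ext fun n => ?_
  have h0 : u = 0 := h0
  simp [(hG u v).1 h n, h0]

lemma mem_graph_of_isDiag {A : E →ₗ.[ℂ] E} {a : ℕ → ℝ} (hA : IsDiag A P a) (n : ℕ) (x : E) :
    (P n x, (a n : ℂ) • P n x) ∈ A.graph := by
  rw [hA]
  intro m
  rw [map_smul, hP.apply_apply]
  split_ifs with h <;> simp [h]

lemma mem_domain_iff_of_isDiag [CompleteSpace E] {A : E →ₗ.[ℂ] E} {a : ℕ → ℝ} (hA : IsDiag A P a)
    (x : E) : x ∈ A.domain ↔ ∑' n, ‖a n‖ₑ ^ 2 * ‖P n x‖ₑ ^ 2 ≠ ⊤ := by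
  have e : ∀ n, ‖a n‖ₑ ^ 2 * ‖P n x‖ₑ ^ 2 = ‖(a n : ℂ) • P n x‖ₑ ^ 2 := fun n => by
    rw [enorm_smul, mul_pow]
    congr 2
    simp [← ofReal_norm]
  simp only [e]
  rw [LinearPMap.mem_domain_iff]
  constructor
  · rintro ⟨y, hy⟩
    have := (hA x y).1 hy
    simp only [← this, hP.tsum_enorm_sq]
    exact ENNReal.pow_ne_top enorm_ne_top
  · intro h
    have hs : Summable fun n => ‖(a n : ℂ) • P n x‖ ^ 2 := by
      have := ENNReal.summable_toReal h
      simpa using this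
    obtain ⟨y, hy⟩ := hP.exists_of_summable
      (fun n => by rw [map_smul, hP.apply_self]) hs
    exact ⟨y, (hA x y).2 hy⟩

lemma enorm_sq_of_isDiag {A : E →ₗ.[ℂ] E} {a : ℕ → ℝ} (hA : IsDiag A P a) (x : A.domain) :
    ‖A x‖ₑ ^ 2 = ∑' n, ‖a n‖ₑ ^ 2 * ‖P n (x : E)‖ₑ ^ 2 := by
  rw [← hP.tsum_enorm_sq]
  refine tsum_congr fun n => ?_
  rw [(hA x (A x)).1 (A.mem_graph x) n, enorm_smul, mul_pow]
  congr 2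
  simp [← ofReal_norm]

lemma dense_domain_of_isDiag {A : E →ₗ.[ℂ] E} {a : ℕ → ℝ} (hA : IsDiag A P a) :
    Dense (A.domain : Set E) := by
  intro x
  refine mem_closure_of_tendsto (hP.hasSum x) (Eventually.of_forall fun s => ?_)
  exact A.domain.sum_mem fun n _ =>
    LinearPMap.mem_domain_iff.2 ⟨_, hP.mem_graph_of_isDiag hA n x⟩

/-- The adjoint of a graph containing all eigenvectors is contained in the diagonal graph. -/
lemma apply_of_mem_adjoint {G : Submodule ℂ (E × E)} {a : ℕ → ℝ}
    (hG : ∀ n x, (P n x, (a n : ℂ) • P n x) ∈ G) {x y : E} (h : (x, y) ∈ G.adjoint) (n : ℕ) :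
    P n y = (a n : ℂ) • P n x := by
  rw [mem_adjoint_iff] at h
  refine ext_inner_left ℂ fun w => ?_
  have := sub_eq_zero.1 (h _ _ (hG n w))
  rw [← hP.inner_symm, ← this, inner_smul_left, inner_smul_right, hP.inner_symm, Complex.conj_ofReal]

variable [CompleteSpace E]

/-- Testing the adjoint against eigenvectors puts it inside the diagonal graph; the reverse
inclusion is Parseval with real eigenvalues. -/
lemma isSelfAdjoint_of_isDiag {A : E →ₗ.[ℂ] E} {a : ℕ → ℝ} (hA : IsDiag A P a) :
    IsSelfAdjoint A := by
  rw [LinearPMap.isSelfAdjoint_def]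
  refine LinearPMap.eq_of_eq_graph ?_
  rw [LinearPMap.adjoint_graph_eq_graph_adjoint (hP.dense_domain_of_isDiag hA)]
  ext ⟨x, y⟩
  refine ⟨fun h => (hA x y).2 fun n =>
    hP.apply_of_mem_adjoint (hP.mem_graph_of_isDiag hA) h n, fun h => ?_⟩
  rw [mem_adjoint_iff]
  intro u v huv
  rw [sub_eq_zero, ← (hP.hasSum_inner v x).tsum_eq, ← (hP.hasSum_inner u y).tsum_eq]
  refine tsum_congr fun n => ?_
  rw [(hA _ _).1 huv n, (hA _ _).1 h n, inner_smul_left, inner_smul_right, Complex.conj_ofReal]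

lemma isNonnegSqrt_of_isDiag {A B : E →ₗ.[ℂ] E} {a : ℕ → ℝ} (ha : ∀ n, 0 ≤ a n)
    (hA : IsDiag A P a) (hB : IsDiag B P fun n => √(a n)) : IsNonnegSqrt A B := by
  refine ⟨hP.isSelfAdjoint_of_isDiag hB, fun x => ?_, fun x z => ?_⟩
  · have := Complex.reCLM.hasSum (hP.hasSum_inner (x : E) (B x))
    refine this.nonneg fun n => ?_
    rw [(hB _ _).1 (B.mem_graph x) n, inner_smul_right, Complex.reCLM_apply, Complex.re_ofReal_mul]
    exact mul_nonneg (Real.sqrt_nonneg _) (inner_self_nonneg (𝕜 := ℂ))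
  · have hsq : ∀ n, ((√(a n) : ℝ) : ℂ) * (√(a n) : ℝ) = a n := fun n => by
      rw [← Complex.ofReal_mul, Real.mul_self_sqrt (ha n)]
    constructor
    · intro h
      have h := (hA _ _).1 h
      -- This is `a ≤ 1 + a²`: the domain of `A` lies in that of its square root.
      have hle : ∀ n, ‖((√(a n) : ℝ) : ℂ) • P n x‖ ^ 2 ≤ ‖P n x‖ ^ 2 + ‖P n z‖ ^ 2 := fun n => by
        rw [h n, norm_smul, norm_smul, mul_pow, mul_pow, Complex.norm_real, Complex.norm_real,
          Real.norm_eq_abs, Real.norm_eq_abs, sq_abs, sq_abs, Real.sq_sqrt (ha n)]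
        nlinarith [sq_nonneg ‖P n x‖, sq_nonneg (a n - 1), ha n]
      have hs : Summable fun n => ‖((√(a n) : ℝ) : ℂ) • P n x‖ ^ 2 :=
        Summable.of_nonneg_of_le (fun n => sq_nonneg _) hle
          ((hP.hasSum_norm_sq x).summable.add (hP.hasSum_norm_sq z).summable)
      obtain ⟨y, hy⟩ := hP.exists_of_summable (fun n => by rw [map_smul, hP.apply_self]) hs
      exact ⟨y, (hB _ _).2 hy, (hB _ _).2 fun n => by rw [hy, smul_smul, hsq, h]⟩
    · rintro ⟨y, hxy, hyz⟩
      exact (hA _ _).2 fun n => by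
        rw [(hB _ _).1 hyz n, (hB _ _).1 hxy n, smul_smul, hsq]

/-- Uniqueness of the square root. It suffices that `B` multiplies each eigenvector of `A` by the
root of its eigenvalue; closedness and self-adjointness of `B` then determine the whole graph. -/
lemma isDiag_of_isNonnegSqrt {A B : E →ₗ.[ℂ] E} {a : ℕ → ℝ} (ha : ∀ n, 0 ≤ a n)
    (hA : IsDiag A P a) (hB : IsNonnegSqrt A B) : IsDiag B P fun n => √(a n) := by
  obtain ⟨hsa, hnn, hsq⟩ := hB
  have hadj : B.graph = B.graph.adjoint := by
    rw [← LinearPMap.adjoint_graph_eq_graph_adjoint hsa.dense_domain,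
      LinearPMap.isSelfAdjoint_def.1 hsa]
  have hsymm : ∀ {u v x y : E}, (u, v) ∈ B.graph → (x, y) ∈ B.graph → ⟪v, x⟫_ℂ = ⟪u, y⟫_ℂ := by
    intro u v x y h h'
    rw [hadj, mem_adjoint_iff] at h'
    exact sub_eq_zero.1 (h' _ _ h)
  have hnn' : ∀ {u v : E}, (u, v) ∈ B.graph → 0 ≤ (⟪u, v⟫_ℂ).re := by
    intro u v h
    obtain ⟨w, hw, hw'⟩ := (LinearPMap.mem_graph_iff B).1 h
    have := hnn w
    simp only at hw hw'
    rwa [hw, hw'] at this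
  have heig : ∀ n x, (P n x, ((√(a n) : ℝ) : ℂ) • P n x) ∈ B.graph := by
    intro n x
    set u := P n x
    set r := √(a n)
    have hr : a n = r * r := (Real.mul_self_sqrt (ha n)).symm
    have hr0 : 0 ≤ r := Real.sqrt_nonneg _
    obtain ⟨y, h1, h2⟩ := (hsq _ _).1 (hP.mem_graph_of_isDiag hA n x)
    change (u, y) ∈ B.graph at h1
    change (y, (a n : ℂ) • u) ∈ B.graph at h2
    suffices y = (r : ℂ) • u by rwa [← this]
    rcases hr0.eq_or_lt with h0 | hpos
    -- Eigenvalue zero: `‖B u‖² = ⟪u, B² u⟫ = 0`.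
    · have h3 : ⟪y, y⟫_ℂ = 0 := (hsymm h1 h2).trans (by rw [hr, ← h0]; simp)
      rw [inner_self_eq_zero.1 h3, ← h0]; simp
    -- With `B² u = r² u`, the vector `w = B u - r u` satisfies `B w = -r w`; non-negativity of `B`
    -- and `r > 0` force `w = 0`.
    · set w := y - (r : ℂ) • u with hw
      have h3 : (w, (-r : ℂ) • w) ∈ B.graph := by
        have := B.graph.sub_mem h2 (B.graph.smul_mem (r : ℂ) h1)
        convert this using 1
        simp only [Prod.smul_mk, Prod.mk_sub_mk, hw, hr]
        congr 1
        rw [smul_sub, smul_smul]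
        push_cast
        rw [neg_mul, neg_smul, neg_smul]
        abel
      have h4 := hnn' h3
      rw [inner_smul_right, inner_self_eq_norm_sq_to_K] at h4
      have h5 : 0 ≤ -r * ‖w‖ ^ 2 := by
        have e : ((-r : ℂ) * ((‖w‖ : ℝ) : ℂ) ^ 2) = ((-r * ‖w‖ ^ 2 : ℝ) : ℂ) := by push_cast; ring
        have h4 : 0 ≤ ((-r : ℂ) * ((‖w‖ : ℝ) : ℂ) ^ 2).re := h4
        rwa [e, Complex.ofReal_re] at h4
      have h6 : ‖w‖ = 0 := by
        by_contra hne
        have : 0 < ‖w‖ ^ 2 := by positivity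
        nlinarith
      exact sub_eq_zero.1 (norm_eq_zero.1 h6)
  intro x y
  refine ⟨fun h n => hP.apply_of_mem_adjoint heig (hadj ▸ h) n, fun h => ?_⟩
  refine hsa.isClosed.mem_of_tendsto ((hP.hasSum x).prodMk_nhds (hP.hasSum y))
    (Eventually.of_forall fun s => ?_)
  have : (∑ n ∈ s, P n x, ∑ n ∈ s, P n y) = ∑ n ∈ s, (P n x, P n y) := by
    ext <;> simp [Prod.fst_sum, Prod.snd_sum]
  rw [SetLike.mem_coe, this]
  exact B.graph.sum_mem fun n _ => by rw [h n]; exact heig n x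

/-- Existence makes the choice in `opSqrt` meaningful, and uniqueness identifies what was chosen. -/
lemma isDiag_opSqrt {A : E →ₗ.[ℂ] E} {a : ℕ → ℝ} (ha : ∀ n, 0 ≤ a n)
    (hA : IsDiag A P a) : IsDiag (opSqrt A) P fun n => √(a n) := by
  refine hP.isDiag_of_isNonnegSqrt ha hA (Classical.epsilon_spec (p := IsNonnegSqrt A) ?_)
  exact ⟨_, hP.isNonnegSqrt_of_isDiag ha hA
    (hP.isDiag_of_graph (G := diagGraph P fun n => √(a n)) rfl fun _ _ => Iff.rfl)⟩

end IsResolution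

end Abstract

/-! ### Tensoring with the identity and conjugation by isometries -/

section TensorOperators

variable {E F G : Type*} [NormedAddCommGroup E] [InnerProductSpace ℂ E]
  [NormedAddCommGroup F] [InnerProductSpace ℂ F] [NormedAddCommGroup G] [InnerProductSpace ℂ G]

/-- Tensoring with a fixed vector on the left, as a continuous linear map. -/
def elemTensorL (x : E) : F →L[ℂ] HilbertTensor E F :=
  UniformSpace.Completion.toComplL.comp (TensorProduct.mkL ℂ E F x)

@[simp] lemma elemTensorL_apply (x : E) (y : F) : elemTensorL x y = elemTensor x y := rfl

lemma inner_elemTensor (x x' : E) (y y' : F) :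
    ⟪elemTensor x y, elemTensor x' y'⟫_ℂ = ⟪x, x'⟫_ℂ * ⟪y, y'⟫_ℂ := by
  rw [elemTensor, elemTensor, UniformSpace.Completion.inner_coe, TensorProduct.inner_tmul]

lemma IsTotal.tensor {S : Set E} {T : Set F} (hS : IsTotal S) (hT : IsTotal T) :
    IsTotal {z : HilbertTensor E F | ∃ x ∈ S, ∃ y ∈ T, z = elemTensor x y} := by
  rw [isTotal_iff]
  intro K hK h
  have h0 : ∀ x ∈ S, ∀ y : F, elemTensor x y ∈ K := fun x hx y =>
    hT.le_of_subset (K := K.comap (elemTensorL (F := F) x).toLinearMap)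
      (hK.preimage (elemTensorL x).continuous) (fun y hy => h ⟨x, hx, y, hy, rfl⟩) y
  have h1 : ∀ (x : E) (y : F), elemTensor x y ∈ K := fun x y => by
    let L : E →L[ℂ] HilbertTensor E F :=
      UniformSpace.Completion.toComplL.comp ((TensorProduct.mkL ℂ E F).flip y)
    exact hS.le_of_subset (K := K.comap L.toLinearMap)
      (hK.preimage L.continuous) (fun x hx => h0 x hx y) x
  intro z
  induction z using UniformSpace.Completion.induction_on with
  | hp => exact hK
  | ih z =>
    induction z with
    | zero => rw [UniformSpace.Completion.coe_zero]; exact K.zero_mem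
    | tmul x y => exact h1 x y
    | add a b ha hb => rw [UniformSpace.Completion.coe_add]; exact K.add_mem ha hb

lemma isTotal_univ : IsTotal (Set.univ : Set E) := by
  rw [isTotal_iff]
  exact fun K _ h x => h trivial

lemma IsTotal.elemTensor {T : Set F} (hT : IsTotal T) :
    IsTotal {z : HilbertTensor E F | ∃ (x : E), ∃ y ∈ T, z = elemTensor x y} := by
  simpa using (isTotal_univ (E := E)).tensor hT

/-- A relation `S` generating an isometry `U`, tensored with the identity, generates an isometry
acting by `x ⊗ y ↦ x ⊗ U y`. -/
lemma exists_idTensor_isometry {A : F →ₗ.[ℂ] G} {U : F →ₗᵢ[ℂ] G}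
    (hA : ∀ x y, (x, y) ∈ A.graph ↔ U x = y) :
    ∃ V : HilbertTensor E F →ₗᵢ[ℂ] HilbertTensor E G,
      (∀ x y, (x, y) ∈ (idTensor E A).graph ↔ V x = y) ∧
      ∀ x y, V (elemTensor x y) = elemTensor x (U y) := by
  have hAU : ∀ y : A.domain, A y = U y := fun y => ((hA _ _).1 (A.mem_graph y)).symm
  have hdom : ∀ y : F, y ∈ A.domain := fun y =>
    LinearPMap.mem_domain_iff.2 ⟨_, (hA y (U y)).2 rfl⟩
  obtain ⟨V, hV, hV'⟩ := exists_isometry_of_gram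
    {p : HilbertTensor E F × HilbertTensor E G |
      ∃ (x : E) (y : A.domain), p = (elemTensor x (y : F), elemTensor x (A y))} (by
    rintro _ ⟨x, y, rfl⟩ _ ⟨x', y', rfl⟩
    simp only [inner_elemTensor, hAU, LinearIsometry.inner_map_map]) (by
    rw [isTotal_iff]
    refine fun K hK h => (isTotal_univ.elemTensor (E := E) (F := F)).le_of_subset hK ?_
    rintro _ ⟨x, y, -, rfl⟩
    exact h ⟨_, ⟨x, ⟨y, hdom y⟩, rfl⟩, rfl⟩)
  refine ⟨V, hV, fun x y => ?_⟩
  rw [← hAU ⟨y, hdom y⟩]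
  exact hV' _ ⟨x, ⟨y, hdom y⟩, rfl⟩

/-- The operator `I ⊗ P` for an orthogonal projection `P`. -/
lemma exists_idTensor_projection {P : F →L[ℂ] F} (hs : ∀ x y, ⟪P x, y⟫_ℂ = ⟪x, P y⟫_ℂ)
    (hi : ∀ x, P (P x) = P x) :
    ∃ Q : HilbertTensor E F →L[ℂ] HilbertTensor E F,
      ∀ x y, Q (elemTensor x y) = elemTensor x (P y) := by
  have hn : ∀ y, ⟪P y, P y⟫_ℂ = ⟪P y, y⟫_ℂ := fun y => by rw [← hs, hi]
  -- The reflection `1 - 2P` is isometric, so it can be tensored by the previous lemma; `I ⊗ P` is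
  -- recovered as `(1 - V) / 2`.
  let U : F →ₗᵢ[ℂ] F := LinearMap.isometryOfInner
    (LinearMap.id - (2 : ℂ) • (P : F →ₗ[ℂ] F)) fun x y => by
      simp only [LinearMap.sub_apply, LinearMap.id_apply, LinearMap.smul_apply,
        ContinuousLinearMap.coe_coe, inner_sub_left, inner_sub_right, inner_smul_left,
        inner_smul_right, hs, hi, map_ofNat]
      ring
  have hU : ∀ y, U y = y - (2 : ℂ) • P y := fun y => rfl
  obtain ⟨V, -, hV⟩ := exists_idTensor_isometry (E := E) (A := (U.toLinearMap).toPMap ⊤) (U := U)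
    (fun x y => by simp [LinearPMap.mem_graph_iff])
  refine ⟨(1 / 2 : ℂ) • (ContinuousLinearMap.id ℂ _ - V.toContinuousLinearMap), fun x y => ?_⟩
  have e : elemTensor x (U y) = elemTensor x y - (2 : ℂ) • elemTensor x (P y) := by
    simp only [← elemTensorL_apply, hU, map_sub, map_smul]
  simp [hV, e]

lemma IsResolution.exists_tensor {P : ℕ → F →L[ℂ] F} (hP : IsResolution P) :
    ∃ Q : ℕ → HilbertTensor E F →L[ℂ] HilbertTensor E F, IsResolution Q ∧
      ∀ n x y, Q n (elemTensor x y) = elemTensor x (P n y) := by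
  choose Q hQ using fun n => exists_idTensor_projection (E := E) (hP.inner_symm n) (hP.apply_self n)
  refine ⟨Q, .of_total (fun n => ?_) (hP.total.elemTensor (E := E)) ?_, hQ⟩
  · refine (isTotal_univ.elemTensor (E := E) (F := F)).inner_symm ?_
    rintro _ ⟨x, y, -, rfl⟩ _ ⟨x', y', -, rfl⟩
    rw [hQ, hQ, inner_elemTensor, inner_elemTensor, hP.inner_symm]
  · rintro _ ⟨x, y, ⟨m, hm⟩, rfl⟩
    refine ⟨m, fun n => ?_⟩
    rw [hQ, hm]
    split_ifs
    · rfl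
    · rw [← elemTensorL_apply, map_zero]

/-- If `A` is diagonal then `I ⊗ A` is diagonal. -/
lemma IsDiag.idTensor {A : F →ₗ.[ℂ] F} {P : ℕ → F →L[ℂ] F} {a : ℕ → ℝ}
    (hA : IsDiag A P a) (hP : IsResolution P)
    {Q : ℕ → HilbertTensor E F →L[ℂ] HilbertTensor E F} (hQ : IsResolution Q)
    (hPQ : ∀ n x y, Q n (elemTensor x y) = elemTensor x (P n y)) :
    IsDiag (idTensor E A) Q a := by
  refine hQ.isDiag_of_graph rfl fun u v => ?_
  set S := {p : HilbertTensor E F × HilbertTensor E F |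
    ∃ (x : E) (y : A.domain), p = (FockNumber.elemTensor x (y : F), FockNumber.elemTensor x (A y))}
  have hle : (span ℂ S).topologicalClosure ≤ diagGraph Q a := by
    refine topologicalClosure_minimal _ (span_le.2 ?_) (isClosed_diagGraph Q a)
    rintro _ ⟨x, y, rfl⟩ n
    rw [hPQ, hPQ, (hA _ _).1 (A.mem_graph y) n]
    simp only [← elemTensorL_apply, map_smul]
  refine ⟨fun h => hle h, fun h => ?_⟩
  -- The closure contains the eigenvector pairs, since this can be checked on elementary tensors;
  -- truncating to finite sums of `Q n` then reaches every pair of the diagonal graph.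
  have hn : ∀ n u, (Q n u, (a n : ℂ) • Q n u) ∈ (span ℂ S).topologicalClosure := by
    intro n
    let L := (Q n).prod ((a n : ℂ) • Q n)
    refine (isTotal_univ.elemTensor (E := E) (F := F)).le_of_subset
      (K := (span ℂ S).topologicalClosure.comap L.toLinearMap)
      ((isClosed_topologicalClosure _).preimage L.continuous) ?_
    rintro _ ⟨x, y, -, rfl⟩
    refine le_topologicalClosure _ (subset_span ?_)
    have hg := hP.mem_graph_of_isDiag hA n y
    refine ⟨x, ⟨P n y, LinearPMap.mem_domain_iff.2 ⟨_, hg⟩⟩, ?_⟩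
    rw [mem_graph_unique (A.mem_graph ⟨P n y, LinearPMap.mem_domain_iff.2 ⟨_, hg⟩⟩) hg]
    change (Q n _, (a n : ℂ) • Q n _) = _
    rw [hPQ]
    simp only [← elemTensorL_apply, map_smul]
  refine (isClosed_topologicalClosure _).mem_of_tendsto ((hQ.hasSum u).prodMk_nhds (hQ.hasSum v))
    (Eventually.of_forall fun s => ?_)
  have : (∑ n ∈ s, Q n u, ∑ n ∈ s, Q n v) = ∑ n ∈ s, (Q n u, Q n v) := by
    ext <;> simp [Prod.fst_sum, Prod.snd_sum]
  rw [this]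
  exact sum_mem fun n _ => by rw [h n]; exact hn n u

/-- The conjugate `U* A U` of a diagonal operator by an isometry `U` whose domain is spanned by
vectors mapped to eigenvectors of `A`. -/
lemma exists_resolution_conjBy [CompleteSpace E] [CompleteSpace F] {W : E →ₗ.[ℂ] F}
    {V : E →ₗᵢ[ℂ] F} (hW : ∀ x y, (x, y) ∈ W.graph ↔ V x = y) {A : F →ₗ.[ℂ] F}
    {P : ℕ → F →L[ℂ] F} {a : ℕ → ℝ} (hP : IsResolution P) (hA : IsDiag A P a)
    {S : Set E} (hS : IsTotal S)
    (hm : ∀ s ∈ S, ∃ m, ∀ n, P n (V s) = if n = m then V s else 0) :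
    ∃ Q : ℕ → E →L[ℂ] E, IsResolution Q ∧ IsDiag (conjBy W A) Q a ∧
      ∀ n x, V (Q n x) = P n (V x) := by
  set V' := V.toContinuousLinearMap
  -- `V* P n V` is again a resolution because `V` sends the total set `S` to eigenvectors, on which
  -- `V* V = 1` applies.
  let Q : ℕ → E →L[ℂ] E := fun n => (ContinuousLinearMap.adjoint V').comp ((P n).comp V')
  have hVV : ∀ x, ContinuousLinearMap.adjoint V' (V x) = x := fun x => by
    refine ext_inner_right ℂ fun y => ?_
    rw [ContinuousLinearMap.adjoint_inner_left]
    exact V.inner_map_map x y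
  have hQs : ∀ s ∈ S, ∃ m, ∀ n, P n (V s) = (if n = m then V s else 0) ∧
      Q n s = if n = m then s else 0 := fun s hs => by
    obtain ⟨m, hm⟩ := hm s hs
    refine ⟨m, fun n => ⟨hm n, ?_⟩⟩
    change ContinuousLinearMap.adjoint V' (P n (V s)) = _
    rw [hm]
    split_ifs
    · exact hVV s
    · exact map_zero _
  have hQ : IsResolution Q := by
    refine .of_total (fun n x y => ?_) hS fun s hs => (hQs s hs).imp fun m h n => (h n).2
    change ⟪ContinuousLinearMap.adjoint V' (P n (V x)), y⟫_ℂ =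
      ⟪x, ContinuousLinearMap.adjoint V' (P n (V y))⟫_ℂ
    rw [ContinuousLinearMap.adjoint_inner_left, ContinuousLinearMap.adjoint_inner_right]
    exact hP.inner_symm n _ _
  have hVQ : ∀ n x, V (Q n x) = P n (V x) := fun n =>
    hS.ext (A := V'.comp (Q n)) (B := (P n).comp V') fun s hs => by
      change V (Q n s) = P n (V s)
      obtain ⟨m, hm⟩ := hQs s hs
      rw [(hm n).1, (hm n).2]
      split_ifs <;> simp
  refine ⟨Q, hQ, hQ.isDiag_of_graph rfl fun x y => ?_, hVQ⟩
  have key : (V x, V y) ∈ A.graph ↔ ∀ n, Q n y = (a n : ℂ) • Q n x := by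
    rw [hA]
    refine forall_congr' fun n => ?_
    rw [← hVQ, ← hVQ, ← V.map_smul, V.injective.eq_iff]
  rw [← key]
  constructor
  · rintro ⟨⟨u, v⟩, h, hx, hy⟩
    rwa [(hW _ _).1 hx, (hW _ _).1 hy]
  · exact fun h => ⟨(V x, V y), h, (hW _ _).2 rfl, (hW _ _).2 rfl⟩

/-- The abstract form of `N_{>ε}`. The last clause exposes explicit eigenvectors: if `U z` is `u ⊗
v` with `v` in the `m`-th eigenspace of `B`, then `x ⊗ z` is in the `m`-th eigenspace of the
conjugate. -/
lemma exists_resolution_conjBy_idTensor (H : Type*) [NormedAddCommGroup H] [InnerProductSpace ℂ H]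
    {A : E →ₗ.[ℂ] HilbertTensor F G} {U : E →ₗᵢ[ℂ] HilbertTensor F G}
    (hA : ∀ x y, (x, y) ∈ A.graph ↔ U x = y) {B : G →ₗ.[ℂ] G} {R : ℕ → G →L[ℂ] G} {a : ℕ → ℝ}
    (hR : IsResolution R) (hB : IsDiag B R a) {S : Set E} (hS : IsTotal S)
    (hm : ∀ z ∈ S, ∃ m u v, U z = elemTensor u v ∧ ∀ n, R n v = if n = m then v else 0) :
    ∃ Q : ℕ → HilbertTensor H E →L[ℂ] HilbertTensor H E, IsResolution Q ∧
      IsDiag (conjBy (idTensor H A) (idTensor H (idTensor F B))) Q a ∧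
      ∀ x z m u v, U z = elemTensor u v → (∀ n, R n v = if n = m then v else 0) →
        ∀ n, Q n (elemTensor x z) = if n = m then elemTensor x z else 0 := by
  obtain ⟨V, hV, hVv⟩ := exists_idTensor_isometry (E := H) hA
  obtain ⟨R₁, hR₁, hRv₁⟩ := hR.exists_tensor (E := F)
  obtain ⟨R₂, hR₂, hRv₂⟩ := hR₁.exists_tensor (E := H)
  have hdiag := (hB.idTensor hR hR₁ hRv₁).idTensor hR₁ hR₂ hRv₂
  have hV' : ∀ x z m u v, U z = elemTensor u v → (∀ n, R n v = if n = m then v else 0) →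
      ∀ n, R₂ n (V (elemTensor x z)) = if n = m then V (elemTensor x z) else 0 := by
    intro x z m u v hz hv n
    rw [hVv, hz, hRv₂, hRv₁, hv]
    split_ifs
    · rfl
    · rw [← elemTensorL_apply, ← elemTensorL_apply, map_zero, map_zero]
  obtain ⟨Q, hQ, hQd, hQv⟩ := exists_resolution_conjBy hV hR₂ hdiag (hS.elemTensor (E := H)) (by
    rintro _ ⟨x, z, hz, rfl⟩
    obtain ⟨m, u, v, h1, h2⟩ := hm z hz
    exact ⟨m, hV' x z m u v h1 h2⟩)
  refine ⟨Q, hQ, hQd, fun x z m u v hz hv n => V.injective ?_⟩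
  rw [hQv, hV' x z m u v hz hv]
  split_ifs <;> simp

end TensorOperators

/-! ### Comparison of number forms -/

section Comparison

variable {E : Type*} [NormedAddCommGroup E] [InnerProductSpace ℂ E]

/-- The quadratic form `∑ₙ n ‖P n x‖²` of the operator `∑ₙ n P n`. -/
def numberForm (P : ℕ → E →L[ℂ] E) (x : E) : ENNReal := ∑' n : ℕ, (n : ENNReal) * ‖P n x‖ₑ ^ 2

lemma enorm_sqrt_natCast_sq (n : ℕ) : ‖√(n : ℝ)‖ₑ ^ 2 = (n : ENNReal) := by
  rw [← ofReal_norm, ← ENNReal.ofReal_pow (norm_nonneg _), Real.norm_eq_abs, sq_abs,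
    Real.sq_sqrt (Nat.cast_nonneg n), ENNReal.ofReal_natCast]

lemma mem_domain_opSqrt_iff [CompleteSpace E] {A : E →ₗ.[ℂ] E} {P : ℕ → E →L[ℂ] E}
    (hP : IsResolution P) (hA : IsDiag A P fun n => (n : ℝ)) (x : E) :
    x ∈ (opSqrt A).domain ↔ numberForm P x ≠ ⊤ := by
  rw [hP.mem_domain_iff_of_isDiag (hP.isDiag_opSqrt (fun n => Nat.cast_nonneg n) hA)]
  simp only [enorm_sqrt_natCast_sq, numberForm]

lemma enorm_sq_opSqrt [CompleteSpace E] {A : E →ₗ.[ℂ] E} {P : ℕ → E →L[ℂ] E}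
    (hP : IsResolution P) (hA : IsDiag A P fun n => (n : ℝ)) (x : (opSqrt A).domain) :
    ENNReal.ofReal (‖opSqrt A x‖ ^ 2) = numberForm P (x : E) := by
  rw [ENNReal.ofReal_pow (norm_nonneg _), ofReal_norm,
    hP.enorm_sq_of_isDiag (hP.isDiag_opSqrt (fun n => Nat.cast_nonneg n) hA)]
  simp only [enorm_sqrt_natCast_sq, numberForm]

section Pair

variable {P Q : ℕ → E →L[ℂ] E} (hP : IsResolution P) (hQ : IsResolution Q)
  (hPQ : IsTotal {z : E | ∃ k m, k ≤ m ∧ (∀ n, P n z = if n = m then z else 0) ∧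
    ∀ n, Q n z = if n = k then z else 0})
include hPQ

lemma resolution_comm (m n : ℕ) (x : E) : Q m (P n x) = P n (Q m x) := by
  refine hPQ.ext (A := (Q m).comp (P n)) (B := (P n).comp (Q m)) ?_ x
  rintro z ⟨k, l, -, hl, hk⟩
  simp only [ContinuousLinearMap.comp_apply, hl, hk, apply_ite (P n), apply_ite (Q m), map_zero]
  split_ifs <;> rfl

lemma resolution_apply_eq_zero {m n : ℕ} (hmn : n < m) (x : E) : Q m (P n x) = 0 := by
  refine hPQ.ext (A := (Q m).comp (P n)) (B := 0) ?_ x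
  rintro z ⟨k, l, hkl, hl, hk⟩
  simp only [ContinuousLinearMap.comp_apply, hl, hk, apply_ite (Q m), map_zero]
  split_ifs
  · omega
  all_goals rfl

include hP

/-- Parseval for `P` applied to each `Q m x`, using that the two resolutions commute. -/
lemma numberForm_eq (x : E) :
    numberForm Q x = ∑' n, ∑' m : ℕ, (m : ENNReal) * ‖Q m (P n x)‖ₑ ^ 2 := by
  rw [ENNReal.tsum_comm, numberForm]
  refine tsum_congr fun m => ?_
  rw [← hP.tsum_enorm_sq (Q m x), ENNReal.tsum_mul_left]
  simp only [resolution_comm hPQ]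

include hQ in
-- Only terms with `m ≤ n` are nonzero in the double sum, so the weight `m` may be raised to `n`.
lemma numberForm_le (x : E) : numberForm Q x ≤ numberForm P x := by
  rw [numberForm_eq hP hPQ]
  refine ENNReal.tsum_le_tsum fun n => ?_
  rw [← hQ.tsum_enorm_sq (P n x), ← ENNReal.tsum_mul_left]
  refine ENNReal.tsum_le_tsum fun m => ?_
  rcases le_or_gt m n with h | h
  · gcongr
  · simp [resolution_apply_eq_zero hPQ h]

/-- Only the diagonal `m = n` of the double sum is kept: the part in which every particle is counted
by `Q`. -/
lemma le_numberForm (x : E) :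
    ∑' n : ℕ, (n : ENNReal) * ‖Q n (P n x)‖ₑ ^ 2 ≤ numberForm Q x := by
  rw [numberForm_eq hP hPQ]
  exact ENNReal.tsum_le_tsum fun n =>
    ENNReal.le_tsum (f := fun m : ℕ => (m : ENNReal) * ‖Q m (P n x)‖ₑ ^ 2) n

end Pair

lemma iSup_numberForm {P : ℕ → E →L[ℂ] E} (hP : IsResolution P) {Q : ℝ → ℕ → E →L[ℂ] E}
    (hQ : ∀ ε, 0 < ε → IsResolution (Q ε))
    (hPQ : ∀ ε, 0 < ε → IsTotal {z : E | ∃ k m, k ≤ m ∧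
      (∀ n, P n z = if n = m then z else 0) ∧ ∀ n, Q ε n z = if n = k then z else 0})
    (hlim : IsTotal {z : E | ∃ m, (∀ n, P n z = if n = m then z else 0) ∧
      ∀ᶠ k : ℕ in atTop, Q (1 / (k + 1 : ℝ)) m z = z}) (x : E) :
    ⨆ ε : Set.Ioi (0 : ℝ), numberForm (Q ε) x = numberForm P x := by
  refine le_antisymm (iSup_le fun ε => numberForm_le hP (hQ ε ε.2) (hPQ ε ε.2) x) ?_
  have hpos : ∀ k : ℕ, (0 : ℝ) < 1 / (k + 1 : ℝ) := fun k => by positivity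
  -- The operators are contractions, so the limit need only be checked on vectors that `Q`
  -- eventually fixes.
  have hT : ∀ n, Tendsto (fun k : ℕ => Q (1 / (k + 1 : ℝ)) n (P n x)) atTop (𝓝 (P n x)) := by
    intro n
    refine hlim.tendsto (T := fun k : ℕ => (Q (1 / (k + 1 : ℝ)) n).comp (P n)) (T₀ := P n)
      (fun k x => ((hQ _ (hpos k)).norm_le n _).trans (hP.norm_le n x)) (hP.norm_le n) ?_ x
    rintro z ⟨m, hm, hz⟩
    refine tendsto_const_nhds.congr' ?_
    filter_upwards [hz] with k hk
    rw [ContinuousLinearMap.comp_apply, hm]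
    split_ifs with h
    · rw [h, hk]
    · rw [map_zero]
  rw [numberForm, ENNReal.tsum_eq_iSup_sum]
  refine iSup_le fun s => ?_
  have h1 : Tendsto (fun k : ℕ => ∑ n ∈ s, (n : ENNReal) * ‖Q (1 / (k + 1 : ℝ)) n (P n x)‖ₑ ^ 2)
      atTop (𝓝 (∑ n ∈ s, (n : ENNReal) * ‖P n x‖ₑ ^ 2)) :=
    tendsto_finsetSum _ fun n _ => ENNReal.Tendsto.const_mul
      (((ENNReal.continuous_pow 2).tendsto _).comp ((continuous_enorm.tendsto _).comp (hT n)))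
      (Or.inr (ENNReal.natCast_ne_top n))
  refine le_of_tendsto' h1 fun k => ?_
  refine (ENNReal.sum_le_tsum s).trans
    ((le_numberForm hP (hPQ _ (hpos k)) x).trans ?_)
  exact le_iSup (fun ε : Set.Ioi (0 : ℝ) => numberForm (Q ε) x) ⟨_, hpos k⟩

/-- Monotone approximation of a number operator, in terms of square roots. -/
theorem isLUB_opSqrt [CompleteSpace E] {A : E →ₗ.[ℂ] E} {B : ℝ → E →ₗ.[ℂ] E}
    {P : ℕ → E →L[ℂ] E} (hP : IsResolution P) (hA : IsDiag A P fun n => (n : ℝ))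
    {Q : ℝ → ℕ → E →L[ℂ] E} (hQ : ∀ ε, 0 < ε → IsResolution (Q ε))
    (hB : ∀ ε, 0 < ε → IsDiag (B ε) (Q ε) fun n => (n : ℝ))
    (hsup : ∀ x, ⨆ ε : Set.Ioi (0 : ℝ), numberForm (Q ε) x = numberForm P x) :
    {x : E | ∃ h : ∀ ε : ℝ, 0 < ε → x ∈ (opSqrt (B ε)).domain,
      BddAbove (Set.range fun ε : Set.Ioi (0 : ℝ) => ‖opSqrt (B ε) ⟨x, h ε ε.2⟩‖ ^ 2)} =
        ((opSqrt A).domain : Set E) ∧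
    ∀ x ∈ (opSqrt A).domain, ∃ (h : ∀ ε : ℝ, 0 < ε → x ∈ (opSqrt (B ε)).domain)
      (h₀ : x ∈ (opSqrt A).domain),
      IsLUB (Set.range fun ε : Set.Ioi (0 : ℝ) => ‖opSqrt (B ε) ⟨x, h ε ε.2⟩‖ ^ 2)
        (‖opSqrt A ⟨x, h₀⟩‖ ^ 2) := by
  have hmain : ∀ x ∈ (opSqrt A).domain, ∃ (h : ∀ ε : ℝ, 0 < ε → x ∈ (opSqrt (B ε)).domain)
      (h₀ : x ∈ (opSqrt A).domain),
      IsLUB (Set.range fun ε : Set.Ioi (0 : ℝ) => ‖opSqrt (B ε) ⟨x, h ε ε.2⟩‖ ^ 2)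
        (‖opSqrt A ⟨x, h₀⟩‖ ^ 2) := by
    intro x hx
    have hle : ∀ ε : Set.Ioi (0 : ℝ), numberForm (Q ε) x ≤ numberForm P x := fun ε =>
      hsup x ▸ le_iSup (fun ε : Set.Ioi (0 : ℝ) => numberForm (Q ε) x) ε
    have hd : ∀ ε : ℝ, 0 < ε → x ∈ (opSqrt (B ε)).domain := fun ε hε =>
      (mem_domain_opSqrt_iff (hQ ε hε) (hB ε hε) x).2
        (ne_top_of_le_ne_top ((mem_domain_opSqrt_iff hP hA x).1 hx) (hle ⟨ε, hε⟩))
    refine ⟨hd, hx, ?_, ?_⟩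
    · rintro _ ⟨ε, rfl⟩
      refine (ENNReal.ofReal_le_ofReal_iff (sq_nonneg _)).1 ?_
      rw [enorm_sq_opSqrt hP hA, enorm_sq_opSqrt (hQ ε ε.2) (hB ε ε.2)]
      exact hle ε
    · intro c hc
      -- Any `ε` serves here; non-negativity of `c` is needed because `ENNReal.ofReal` truncates
      -- negative numbers to zero.
      have hc0 : 0 ≤ c := (sq_nonneg _).trans (hc ⟨⟨1, Set.mem_Ioi.2 one_pos⟩, rfl⟩)
      refine (ENNReal.ofReal_le_ofReal_iff hc0).1 ?_
      rw [enorm_sq_opSqrt hP hA, ← hsup]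
      refine iSup_le fun ε => ?_
      have := ENNReal.ofReal_le_ofReal (hc ⟨ε, rfl⟩)
      rwa [enorm_sq_opSqrt (hQ ε ε.2) (hB ε ε.2)] at this
  refine ⟨Set.Subset.antisymm ?_ fun x hx => ?_, hmain⟩
  · rintro x ⟨h, c, hc⟩
    refine (mem_domain_opSqrt_iff hP hA x).2 (ne_top_of_le_ne_top ENNReal.ofReal_ne_top
      (b := ENNReal.ofReal c) ?_)
    rw [← hsup]
    refine iSup_le fun ε => ?_
    have := ENNReal.ofReal_le_ofReal (hc ⟨ε, rfl⟩)
    rwa [enorm_sq_opSqrt (hQ ε ε.2) (hB ε ε.2)] at this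
  · obtain ⟨h, _, hl⟩ := hmain x hx
    exact ⟨h, _, hl.1⟩

/-- The sets `S ε n` record vectors fixed by `Q n` without naming the resolution, which is only
known to exist for each `ε > 0`. -/
theorem isLUB_opSqrt_of_exists [CompleteSpace E] {A : E →ₗ.[ℂ] E} {B : ℝ → E →ₗ.[ℂ] E}
    {P : ℕ → E →L[ℂ] E} (hP : IsResolution P) (hA : IsDiag A P fun n => (n : ℝ))
    {S : ℝ → ℕ → Set E} (hB : ∀ ε, 0 < ε → ∃ Q : ℕ → E →L[ℂ] E, IsResolution Q ∧
      IsDiag (B ε) Q (fun n => (n : ℝ)) ∧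
      IsTotal {z : E | ∃ k m, k ≤ m ∧
        (∀ n, P n z = if n = m then z else 0) ∧ ∀ n, Q n z = if n = k then z else 0} ∧
      ∀ n, ∀ z ∈ S ε n, Q n z = z)
    (hS : IsTotal {z : E | ∃ m, (∀ n, P n z = if n = m then z else 0) ∧
      ∀ᶠ k : ℕ in atTop, z ∈ S (1 / (k + 1 : ℝ)) m}) :
    {x : E | ∃ h : ∀ ε : ℝ, 0 < ε → x ∈ (opSqrt (B ε)).domain,
      BddAbove (Set.range fun ε : Set.Ioi (0 : ℝ) => ‖opSqrt (B ε) ⟨x, h ε ε.2⟩‖ ^ 2)} =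
        ((opSqrt A).domain : Set E) ∧
    ∀ x ∈ (opSqrt A).domain, ∃ (h : ∀ ε : ℝ, 0 < ε → x ∈ (opSqrt (B ε)).domain)
      (h₀ : x ∈ (opSqrt A).domain),
      IsLUB (Set.range fun ε : Set.Ioi (0 : ℝ) => ‖opSqrt (B ε) ⟨x, h ε ε.2⟩‖ ^ 2)
        (‖opSqrt A ⟨x, h₀⟩‖ ^ 2) := by
  choose! Q hQ hQd hQT hQS using hB
  refine isLUB_opSqrt hP hA hQ hQd (iSup_numberForm hP hQ hQT ?_)
  rw [isTotal_iff]
  refine fun K hK h => hS.le_of_subset hK fun z hz => h ?_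
  obtain ⟨m, hm, hz⟩ := hz
  refine ⟨m, hm, ?_⟩
  filter_upwards [hz] with k hk
  exact hQS _ (by positivity) m z hk

end Comparison

/-! ### Product tensors in `L²(Xⁿ)` -/

section Tensors

/-- Slots are released from `T` one at a time; in each slot the map is linear and continuous. -/
lemma IsTotal.multilinear {E G : Type*} [NormedAddCommGroup E] [InnerProductSpace ℂ E]
    [NormedAddCommGroup G] [InnerProductSpace ℂ G] {n : ℕ}
    (M : ContinuousMultilinearMap ℂ (fun _ : Fin n => E) G) {T : Set E} (hT : IsTotal T)
    {K : Submodule ℂ G} (hK : IsClosed (K : Set G)) (h : ∀ f, (∀ i, f i ∈ T) → M f ∈ K)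
    (f : Fin n → E) : M f ∈ K := by
  suffices ∀ s : Finset (Fin n), ∀ f, (∀ i ∉ s, f i ∈ T) → M f ∈ K from
    this Finset.univ f fun i hi => absurd (Finset.mem_univ i) hi
  intro s
  induction s using Finset.induction_on with
  | empty => exact fun f hf => h f fun i => hf i (by simp)
  | insert a s _ ih =>
    intro f hf
    let A : E →L[ℂ] G := M.toContinuousLinearMap f a
    have := hT.le_of_subset (K := K.comap A.toLinearMap) (hK.preimage A.continuous) (fun y hy => by
      refine ih (Function.update f a y) fun i hi => ?_
      by_cases hia : i = a
      · subst hia; simpa using hy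
      · rw [Function.update_of_ne hia]
        exact hf i (by simp [hia, hi])) (f a)
    have this : M (Function.update f a (f a)) ∈ K := this
    rwa [Function.update_eq_self] at this

variable {X : Type*} [MeasurableSpace X] {μ : Measure X} [SigmaFinite μ] {n : ℕ}

lemma coeFn_tensor (f : Fin n → L2 μ) :
    tensor f =ᵐ[Measure.pi fun _ : Fin n => μ] fun x => ∏ i, f i (x i) :=
  (memLp_tensor f).coeFn_toLp

lemma ae_eval {p : Fin n → X → Prop} (h : ∀ i, ∀ᵐ k ∂μ, p i k) :
    ∀ᵐ x ∂(Measure.pi fun _ : Fin n => μ), ∀ i, p i (x i) :=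
  eventually_all.2 fun i => (Measure.quasiMeasurePreserving_eval (fun _ : Fin n => μ) i).ae (h i)

lemma inner_tensor (f g : Fin n → L2 μ) :
    ⟪tensor f, tensor g⟫_ℂ = ∏ i, ⟪f i, g i⟫_ℂ := by
  simp only [L2.inner_def]
  rw [← integral_fintype_prod_eq_prod (𝕜 := ℂ) (fun i x => ⟪f i x, g i x⟫_ℂ)]
  refine integral_congr_ae ?_
  filter_upwards [coeFn_tensor f, coeFn_tensor g] with x hf hg
  rw [hf, hg]
  simp [RCLike.inner_apply, map_prod, Finset.prod_mul_distrib]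

omit [SigmaFinite μ] in
lemma prod_update_apply (f : Fin n → L2 μ) (i : Fin n) (a : L2 μ) (x : Fin n → X) :
    ∏ j, (Function.update f i a j) (x j) = a (x i) * ∏ j ∈ Finset.univ.erase i, f j (x j) := by
  rw [← Finset.mul_prod_erase Finset.univ _ (Finset.mem_univ i), Function.update_self]
  congr 1
  refine Finset.prod_congr rfl fun j hj => ?_
  rw [Function.update_of_ne (Finset.ne_of_mem_erase hj)]

variable (μ n) in
/-- The tensor `f₁ ⊗ ⋯ ⊗ fₙ` as a continuous multilinear map. -/
def tensorM : ContinuousMultilinearMap ℂ (fun _ : Fin n => L2 μ) (L2Pow μ n) :=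
  MultilinearMap.mkContinuous
    { toFun := tensor
      map_update_add' := by
        intro inst f i a b
        obtain rfl : inst = instDecidableEqFin n := Subsingleton.elim _ _
        refine Lp.ext ?_
        refine (coeFn_tensor _).trans (EventuallyEq.trans ?_ (Lp.coeFn_add _ _).symm)
        filter_upwards [coeFn_tensor (Function.update f i a), coeFn_tensor (Function.update f i b),
          ae_eval (fun _ => Lp.coeFn_add a b)] with x h1 h2 h3
        rw [Pi.add_apply, h1, h2, prod_update_apply, prod_update_apply, prod_update_apply, h3 i,
          Pi.add_apply, add_mul]
      map_update_smul' := by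
        intro inst f i c a
        obtain rfl : inst = instDecidableEqFin n := Subsingleton.elim _ _
        refine Lp.ext ?_
        refine (coeFn_tensor _).trans (EventuallyEq.trans ?_ (Lp.coeFn_smul _ _).symm)
        filter_upwards [coeFn_tensor (Function.update f i a),
          ae_eval (fun _ => Lp.coeFn_smul c a)] with x h1 h3
        rw [Pi.smul_apply, h1, prod_update_apply, prod_update_apply, h3 i,
          Pi.smul_apply, smul_eq_mul, smul_eq_mul, mul_assoc] } 1 fun f => by
    have h := inner_tensor f f
    have h2 : ‖tensor f‖ ^ 2 = (∏ i, ‖f i‖) ^ 2 := by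
      simp only [inner_self_eq_norm_sq_to_K] at h
      rw [← Finset.prod_pow]
      exact_mod_cast h
    rw [one_mul]
    exact ((sq_eq_sq₀ (norm_nonneg _) (Finset.prod_nonneg fun i _ => norm_nonneg _)).1 h2).le

@[simp] lemma tensorM_apply (f : Fin n → L2 μ) : tensorM μ n f = tensor f := rfl

lemma tensor_indicator {s : Fin n → Set X} (hs : ∀ i, MeasurableSet (s i))
    (hμ : ∀ i, μ (s i) ≠ ⊤) (hm : MeasurableSet (Set.univ.pi s))
    (hμ' : Measure.pi (fun _ : Fin n => μ) (Set.univ.pi s) ≠ ⊤) :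
    tensor (fun i => indicatorConstLp 2 (hs i) (hμ i) (1 : ℂ)) =
      indicatorConstLp 2 hm hμ' (1 : ℂ) := by
  refine Lp.ext ?_
  refine (coeFn_tensor _).trans (EventuallyEq.trans ?_ indicatorConstLp_coeFn.symm)
  filter_upwards [ae_eval (fun i => indicatorConstLp_coeFn (p := 2) (hs := hs i) (hμs := hμ i)
    (c := (1 : ℂ)))] with x hx
  rw [Finset.prod_congr rfl fun i _ => hx i]
  by_cases h : x ∈ Set.univ.pi s
  · rw [Set.indicator_of_mem h]
    exact Finset.prod_eq_one fun i _ => Set.indicator_of_mem (h i trivial) _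
  · rw [Set.indicator_of_notMem h]
    simp only [Set.mem_pi, not_forall] at h
    obtain ⟨i, -, hi⟩ := h
    exact Finset.prod_eq_zero (Finset.mem_univ i) (Set.indicator_of_notMem hi _)

/-- Indicators of finite-measure boxes are product tensors, so `g` integrates to zero over boxes. A
π-λ argument inside boxes `B N` of finite measure, which exhaust `Xⁿ`, gives `g = 0` almost
everywhere. -/
lemma eq_zero_of_inner_tensor {g : L2Pow μ n} (hg : ∀ f : Fin n → L2 μ, ⟪tensor f, g⟫_ℂ = 0) :
    g = 0 := by
  set ν := Measure.pi fun _ : Fin n => μ with hν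
  have hrect : ∀ s : Fin n → Set X, (∀ i, MeasurableSet (s i)) → (∀ i, μ (s i) ≠ ⊤) →
      ∫ x in Set.univ.pi s, g x ∂ν = 0 := by
    intro s hs hμ
    have hm : MeasurableSet (Set.univ.pi s) := MeasurableSet.univ_pi hs
    have hμ' : ν (Set.univ.pi s) ≠ ⊤ := by
      rw [hν, Measure.pi_pi]
      exact ENNReal.prod_ne_top fun i _ => hμ i
    rw [← L2.inner_indicatorConstLp_one (𝕜 := ℂ) hm hμ' g, ← tensor_indicator hs hμ hm hμ']
    exact hg _
  let B : ℕ → Set (Fin n → X) := fun N => Set.univ.pi fun _ => spanningSets μ N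
  have hB : ∀ N, MeasurableSet (B N) := fun N =>
    MeasurableSet.univ_pi fun _ => measurableSet_spanningSets μ N
  have hBfin : ∀ N, ν (B N) < ⊤ := fun N => by
    rw [hν, Measure.pi_pi]
    exact ENNReal.prod_lt_top fun i _ => measure_spanningSets_lt_top μ N
  have hint : ∀ N, IntegrableOn g (B N) ν := fun N => by
    have : IsFiniteMeasure (ν.restrict (B N)) := ⟨by simpa using hBfin N⟩
    exact ((Lp.memLp g).restrict (B N)).integrable (by norm_num)
  have hzero : ∀ N, ∀ A, MeasurableSet A → ∫ x in A, g x ∂(ν.restrict (B N)) = 0 := by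
    intro N A hA
    induction A, hA using MeasurableSpace.induction_on_inter
      (generateFrom_pi (α := fun _ : Fin n => X)).symm isPiSystem_pi with
    | empty => simp
    | basic A hA =>
      obtain ⟨s, hs, rfl⟩ := hA
      have hs : ∀ i, MeasurableSet (s i) := fun i => hs i trivial
      rw [Measure.restrict_restrict (MeasurableSet.univ_pi hs), ← Set.pi_inter_distrib]
      exact hrect _ (fun i => (hs i).inter (measurableSet_spanningSets μ N))
        fun i => ((measure_mono Set.inter_subset_right).trans_lt
          (measure_spanningSets_lt_top μ N)).ne
    | compl A hA ih =>
      have := integral_add_compl hA (hint N)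
      rw [ih, zero_add] at this
      rw [this]
      exact hrect _ (fun i => measurableSet_spanningSets μ N)
        fun i => (measure_spanningSets_lt_top μ N).ne
    | iUnion f hd hm ih =>
      rw [integral_iUnion hm hd (hint N).integrableOn]
      simp [ih]
  have hae : ∀ N, ∀ᵐ x ∂ν, x ∈ B N → g x = 0 := fun N =>
    (ae_restrict_iff' (hB N)).1
      (Integrable.ae_eq_zero_of_forall_setIntegral_eq_zero (hint N) fun A hA _ => hzero N A hA)
  refine (Lp.eq_zero_iff_ae_eq_zero).2 ?_
  filter_upwards [ae_all_iff.2 hae] with x hx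
  choose N hN using fun i => Set.mem_iUnion.1 (iUnion_spanningSets μ ▸ Set.mem_univ (x i))
  refine hx (Finset.univ.sup N) fun i _ => ?_
  exact monotone_spanningSets μ (Finset.le_sup (Finset.mem_univ i)) (hN i)

lemma isTotal_tensor {T : Set (L2 μ)} (hT : IsTotal T) :
    IsTotal {z : L2Pow μ n | ∃ f : Fin n → L2 μ, (∀ i, f i ∈ T) ∧ z = tensor f} := by
  rw [isTotal_iff]
  intro K hK h z
  have hall : ∀ f : Fin n → L2 μ, tensor f ∈ K :=
    hT.multilinear (tensorM μ n) hK fun f hf => h ⟨f, hf, rfl⟩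
  have : CompleteSpace K := hK.completeSpace_coe
  rw [← K.orthogonal_orthogonal, mem_orthogonal]
  intro u hu
  have : u = 0 := eq_zero_of_inner_tensor fun f => (mem_orthogonal K u).1 hu _ (hall f)
  rw [this, inner_zero_left]

end Tensors

/-! ### Symmetric tensors -/

section Symmetric

variable {X : Type*} [MeasurableSpace X] {μ : Measure X} [SigmaFinite μ]

lemma coe_symTensor {n : ℕ} (f : Fin n → L2 μ) : (symTensor f : L2Pow μ n) =
    ((Real.sqrt (n.factorial : ℝ) : ℂ)⁻¹) • ∑ τ : Equiv.Perm (Fin n), tensor fun i => f (τ i) := rfl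

lemma sqrt_factorial_mul_self (n : ℕ) :
    ((√(n.factorial : ℝ) : ℝ) : ℂ) * (√(n.factorial : ℝ) : ℝ) = (n.factorial : ℂ) := by
  rw [← Complex.ofReal_mul, Real.mul_self_sqrt (Nat.cast_nonneg _), Complex.ofReal_natCast]

lemma sqrt_factorial_ne_zero (n : ℕ) : ((√(n.factorial : ℝ) : ℝ) : ℂ) ≠ 0 := by
  rw [Complex.ofReal_ne_zero]
  have := n.factorial_pos
  positivity

/-- The inner product is a permanent. In the double sum over `τ, ρ` the inner sum does not depend on
`τ`, and the resulting factor `n!` cancels the two normalizations. -/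
lemma inner_symTensor {n : ℕ} (f g : Fin n → L2 μ) :
    ⟪symTensor f, symTensor g⟫_ℂ = ∑ σ : Equiv.Perm (Fin n), ∏ i, ⟪f i, g (σ i)⟫_ℂ := by
  rw [coe_inner, coe_symTensor, coe_symTensor, inner_smul_left, inner_smul_right, sum_inner]
  simp only [inner_sum, inner_tensor]
  have h : ∀ τ : Equiv.Perm (Fin n), ∑ ρ : Equiv.Perm (Fin n), ∏ i, ⟪f (τ i), g (ρ i)⟫_ℂ =
      ∑ σ : Equiv.Perm (Fin n), ∏ i, ⟪f i, g (σ i)⟫_ℂ := fun τ =>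
    Fintype.sum_equiv (Equiv.mulRight τ⁻¹) _ _ fun ρ =>
      Fintype.prod_equiv τ _ _ fun i => by simp
  simp only [h, Finset.sum_const, Finset.card_univ, Fintype.card_perm, Fintype.card_fin,
    nsmul_eq_mul, ← sqrt_factorial_mul_self, map_inv₀, Complex.conj_ofReal]
  have := sqrt_factorial_ne_zero n
  field_simp

lemma symTensor_comp_perm {n : ℕ} (σ : Equiv.Perm (Fin n)) (f : Fin n → L2 μ) :
    (symTensor fun i => f (σ i)) = symTensor f := by
  refine Subtype.ext ?_
  rw [coe_symTensor, coe_symTensor]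
  congr 1
  exact Fintype.sum_equiv (Equiv.mulLeft σ) _ _ fun τ => rfl

/-- `√(n!)` times the symmetrization projection. -/
def symmetrize (μ : Measure X) [SigmaFinite μ] (n : ℕ) : L2Pow μ n →L[ℂ] L2Pow μ n :=
  ((Real.sqrt (n.factorial : ℝ) : ℂ)⁻¹) • ∑ τ : Equiv.Perm (Fin n),
    (Lp.compMeasurePreservingₗᵢ ℂ _ (measurePreserving_perm μ τ)).toContinuousLinearMap

lemma symmetrize_apply {n : ℕ} (ψ : L2Pow μ n) : symmetrize μ n ψ =
    ((Real.sqrt (n.factorial : ℝ) : ℂ)⁻¹) • ∑ τ : Equiv.Perm (Fin n), permute μ τ ψ := by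
  rw [symmetrize, smul_apply, sum_apply]
  rfl

lemma symmetrize_tensor {n : ℕ} (f : Fin n → L2 μ) :
    symmetrize μ n (tensor f) = (symTensor f : L2Pow μ n) := by
  rw [symmetrize_apply, coe_symTensor]
  simp only [permute_tensor]
  congr 1
  exact Fintype.sum_equiv (Equiv.inv _) _ _ fun τ => rfl

lemma symmetrize_mem {n : ℕ} (ψ : L2Pow μ n) : symmetrize μ n ψ ∈ symPow μ n := by
  have hcl : IsClosed (symPow μ n : Set (L2Pow μ n)) := by
    have : (symPow μ n : Set (L2Pow μ n)) = ⋂ σ, {ψ | permute μ σ ψ = ψ} := by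
      ext ψ; exact (Set.mem_iInter (s := fun σ => {ψ | permute μ σ ψ = ψ})).symm
    rw [this]
    exact isClosed_iInter fun σ => isClosed_eq
      (Lp.compMeasurePreservingₗᵢ ℂ _ (measurePreserving_perm μ σ)).continuous continuous_id
  refine (isTotal_tensor isTotal_univ).le_of_subset
    (K := (symPow μ n).comap (symmetrize μ n).toLinearMap)
    (hcl.preimage (symmetrize μ n).continuous) ?_ ψ
  rintro _ ⟨f, -, rfl⟩
  change symmetrize μ n (tensor f) ∈ symPow μ n
  rw [symmetrize_tensor]
  exact (symTensor f).2

lemma symmetrize_of_mem {n : ℕ} (ψ : symPow μ n) :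
    symmetrize μ n ψ = (√(n.factorial : ℝ) : ℂ) • (ψ : L2Pow μ n) := by
  have h : ∀ σ : Equiv.Perm (Fin n), permute μ σ ψ = (ψ : L2Pow μ n) := ψ.2
  rw [symmetrize_apply]
  simp only [h, Finset.sum_const, Finset.card_univ, Fintype.card_perm, Fintype.card_fin]
  rw [← Nat.cast_smul_eq_nsmul ℂ, smul_smul, ← sqrt_factorial_mul_self,
    inv_mul_cancel_left₀ (sqrt_factorial_ne_zero n)]

/-- Symmetrization is continuous, sends product tensors to symmetric tensors, and is a nonzero
scalar on `symPow`; totality transfers from product tensors. -/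
lemma isTotal_symTensor {n : ℕ} {T : Set (L2 μ)} (hT : IsTotal T) :
    IsTotal {z : symPow μ n | ∃ f : Fin n → L2 μ, (∀ i, f i ∈ T) ∧ z = symTensor f} := by
  rw [isTotal_iff]
  intro K hK h z
  let S : L2Pow μ n →L[ℂ] symPow μ n := (symmetrize μ n).codRestrict _ symmetrize_mem
  have hS : ∀ ψ, S ψ ∈ K := by
    refine (isTotal_tensor hT).le_of_subset (K := K.comap S.toLinearMap)
      (hK.preimage S.continuous) ?_
    rintro _ ⟨f, hf, rfl⟩
    have : S (tensor f) = symTensor f := Subtype.ext (symmetrize_tensor f)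
    exact h ⟨f, hf, this⟩
  have hz : S z = (√(n.factorial : ℝ) : ℂ) • z := Subtype.ext (symmetrize_of_mem z)
  exact (K.smul_mem_iff (sqrt_factorial_ne_zero n)).1 (hz ▸ hS z)

end Symmetric

/-! ### Fock space and its number operator -/

section FockSpace

variable {X : Type*} [MeasurableSpace X] {μ : Measure X} [SigmaFinite μ]

lemma isTotal_fockVec {T : Set (L2 μ)} (hT : IsTotal T) :
    IsTotal {z : Fock μ | ∃ (n : ℕ) (f : Fin n → L2 μ), (∀ i, f i ∈ T) ∧ z = fockVec f} := by
  rw [isTotal_iff]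
  intro K hK h z
  have hs : ∀ n (y : symPow μ n), lp.single 2 n y ∈ K := by
    intro n
    let A := lp.singleContinuousLinearMap ℂ (fun n : ℕ => symPow μ n) 2 n
    refine (isTotal_symTensor hT).le_of_subset (K := K.comap A.toLinearMap)
      (hK.preimage A.continuous) ?_
    rintro _ ⟨f, hf, rfl⟩
    exact h ⟨n, f, hf, rfl⟩
  exact hK.mem_of_tendsto (lp.hasSum_single (by simp) z)
    (Eventually.of_forall fun s => K.sum_mem fun n _ => hs n _)

variable (μ) in
/-- The projection of the Fock space onto its `n`-particle subspace. -/
def particleProj (n : ℕ) : Fock μ →L[ℂ] Fock μ :=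
  (lp.singleContinuousLinearMap ℂ (fun n : ℕ => symPow μ n) 2 n).comp
    (lp.evalCLM ℂ (fun n : ℕ => symPow μ n) 2 n)

lemma particleProj_apply (n : ℕ) (ψ : Fock μ) : particleProj μ n ψ = lp.single 2 n (ψ n) := rfl

lemma particleProj_single (n m : ℕ) (y : symPow μ m) :
    particleProj μ n (lp.single 2 m y) = if n = m then lp.single 2 m y else 0 := by
  rw [particleProj_apply]
  split_ifs with h
  · subst h; rw [lp.single_apply_self]
  · rw [lp.single_apply_ne _ _ _ h, lp.single_zero]

lemma particleProj_fockVec (n : ℕ) {m : ℕ} (f : Fin m → L2 μ) :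
    particleProj μ n (fockVec f) = if n = m then fockVec f else 0 :=
  particleProj_single n m _

variable (μ) in
lemma isResolution_particleProj : IsResolution (particleProj μ) := by
  refine .of_total (fun n x y => ?_) (isTotal_fockVec isTotal_univ) ?_
  · rw [particleProj_apply, particleProj_apply, lp.inner_single_left, lp.inner_single_right]
  · rintro _ ⟨n, f, -, rfl⟩
    exact ⟨n, fun m => particleProj_fockVec m f⟩

/-- Each of the `n` summands returns the tensor itself, so the generators lie on the graph of the
bounded operator `n`; totality fills that graph. -/
lemma mem_graph_dGammaN_mulOne (n : ℕ) (x y : symPow μ n) :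
    (x, y) ∈ (dGammaN (mulOne μ) n).graph ↔ y = (n : ℂ) • x := by
  set S := {p : symPow μ n × symPow μ n | ∃ f : Fin n → (mulOne μ).domain,
    p = (symTensor fun i => (f i : L2 μ),
      ∑ j, symTensor (Function.update (fun i => (f i : L2 μ)) j (mulOne μ (f j))))} with hS
  have hmem : ∀ f : Fin n → L2 μ, (symTensor f, (n : ℂ) • symTensor f) ∈ S := fun f => by
    refine ⟨fun i => ⟨f i, trivial⟩, Prod.ext rfl ?_⟩
    have : ∀ j, Function.update f j (mulOne μ ⟨f j, trivial⟩) = f := fun j =>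
      Function.update_eq_self j f
    simp [this, Nat.cast_smul_eq_nsmul]
  have h1 : ∀ p ∈ (span ℂ S).topologicalClosure, p.2 = (n : ℂ) • p.1 := by
    let D : symPow μ n × symPow μ n →L[ℂ] symPow μ n :=
      ContinuousLinearMap.snd ℂ _ _ - (n : ℂ) • ContinuousLinearMap.fst ℂ _ _
    suffices (span ℂ S).topologicalClosure ≤ D.ker from fun p hp => sub_eq_zero.1 (this hp)
    refine topologicalClosure_minimal _ (span_le.2 ?_) D.isClosed_ker
    rintro _ ⟨f, rfl⟩
    have : ∀ j, Function.update (fun i => (f i : L2 μ)) j (mulOne μ (f j)) = fun i => (f i : L2 μ) :=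
      fun j => Function.update_eq_self j _
    simp [D, this, Nat.cast_smul_eq_nsmul]
  rw [dGammaN, toLinearPMap_graph_eq _ fun p hp h0 => by rw [h1 p hp, h0, smul_zero]]
  refine ⟨fun h => h1 _ h, ?_⟩
  rintro rfl
  let A : symPow μ n →L[ℂ] symPow μ n × symPow μ n :=
    (ContinuousLinearMap.id ℂ _).prod ((n : ℂ) • ContinuousLinearMap.id ℂ _)
  refine (isTotal_symTensor isTotal_univ).le_of_subset
    (K := (span ℂ S).topologicalClosure.comap A.toLinearMap)
    ((isClosed_topologicalClosure _).preimage A.continuous) ?_ x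
  rintro _ ⟨f, -, rfl⟩
  exact le_topologicalClosure _ (subset_span (hmem f))

variable (μ) in
lemma isDiag_fockNumber : IsDiag (fockNumber μ) (particleProj μ) fun n => (n : ℝ) := by
  refine (isResolution_particleProj μ).isDiag_of_graph rfl fun x y => ?_
  change (∀ n, (x n, y n) ∈ (dGammaN (mulOne μ) n).graph) ↔ _
  refine forall_congr' fun n => ?_
  rw [mem_graph_dGammaN_mulOne, particleProj_apply, particleProj_apply, Complex.ofReal_natCast,
    ← lp.single_smul]
  refine ⟨fun h => by rw [h], fun h => ?_⟩
  simpa using congrArg (fun z : Fock μ => z n) h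

/-- Summing over bijections covers `m ≠ n` too, where the sum is empty and the sectors are
orthogonal. -/
lemma inner_fockVec {m n : ℕ} (f : Fin m → L2 μ) (g : Fin n → L2 μ) :
    ⟪fockVec f, fockVec g⟫_ℂ = ∑ σ : Fin m ≃ Fin n, ∏ i, ⟪f i, g (σ i)⟫_ℂ := by
  rw [fockVec, fockVec, lp.inner_single_left]
  by_cases h : m = n
  · subst h
    rw [lp.single_apply_self, inner_symTensor]
  · rw [lp.single_apply_ne _ _ _ h, inner_zero_right]
    have : IsEmpty (Fin m ≃ Fin n) := ⟨fun e => h (by simpa using Fintype.card_congr e)⟩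
    simp

lemma fockVec_comp_equiv {m n : ℕ} (e : Fin m ≃ Fin n) (f : Fin n → L2 μ) :
    (fockVec fun i => f (e i)) = fockVec f := by
  obtain rfl : m = n := by simpa using Fintype.card_congr e
  rw [fockVec, fockVec, symTensor_comp_perm]

end FockSpace

/-! ### Permanents of block diagonal matrices -/

section Combinatorics

lemma exists_sumCongr_of_mapsTo {α β α' β' : Type*} (σ : α ⊕ β ≃ α' ⊕ β')
    (hl : ∀ a, ∃ a', σ (Sum.inl a) = Sum.inl a') (hr : ∀ b, ∃ b', σ (Sum.inr b) = Sum.inr b') :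
    ∃ (e : α ≃ α') (e' : β ≃ β'), Equiv.sumCongr e e' = σ := by
  choose f hf using hl
  choose g hg using hr
  have hfb : Function.Bijective f := by
    refine ⟨fun a b h => ?_, fun a' => ?_⟩
    · exact Sum.inl_injective (σ.injective (by rw [hf, hf, h]))
    · obtain ⟨x | x, hx⟩ := σ.surjective (Sum.inl a')
      · exact ⟨x, Sum.inl_injective (by rw [← hf, hx])⟩
      · rw [hg] at hx; cases hx
  have hgb : Function.Bijective g := by
    refine ⟨fun a b h => ?_, fun a' => ?_⟩
    · exact Sum.inr_injective (σ.injective (by rw [hg, hg, h]))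
    · obtain ⟨x | x, hx⟩ := σ.surjective (Sum.inr a')
      · rw [hf] at hx; cases hx
      · exact ⟨x, Sum.inr_injective (by rw [← hg, hx])⟩
  refine ⟨Equiv.ofBijective f hfb, Equiv.ofBijective g hgb, Equiv.ext fun x => ?_⟩
  rcases x with x | x
  · exact (hf x).symm
  · exact (hg x).symm

/-- The permanent of a block diagonal (not necessarily square) matrix. -/
lemma sum_equiv_prod_block {α β α' β' : Type*} [Fintype α] [Fintype β] [Fintype α'] [Fintype β']
    [DecidableEq α] [DecidableEq β] [DecidableEq α'] [DecidableEq β']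
    (M : α ⊕ β → α' ⊕ β' → ℂ) (hlr : ∀ a b, M (Sum.inl a) (Sum.inr b) = 0)
    (hrl : ∀ b a, M (Sum.inr b) (Sum.inl a) = 0) :
    ∑ σ : α ⊕ β ≃ α' ⊕ β', ∏ i, M i (σ i) =
      (∑ e : α ≃ α', ∏ a, M (Sum.inl a) (Sum.inl (e a))) *
        ∑ e : β ≃ β', ∏ b, M (Sum.inr b) (Sum.inr (e b)) := by
  rw [Finset.sum_mul_sum, ← Finset.sum_product']
  symm
  refine Finset.sum_of_injOn (fun p => Equiv.sumCongr p.1 p.2) ?_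
    (fun _ _ => Finset.mem_coe.2 (Finset.mem_univ _)) ?_ ?_
  · rintro ⟨e, e'⟩ - ⟨u, u'⟩ - h
    refine Prod.ext (Equiv.ext fun a => ?_) (Equiv.ext fun b => ?_)
    · exact Sum.inl_injective (Equiv.congr_fun h (Sum.inl a))
    · exact Sum.inr_injective (Equiv.congr_fun h (Sum.inr b))
  -- A bijection with nonzero product never crosses blocks, so it splits as a pair of bijections.
  · rintro σ - hσ
    by_contra hne
    rw [← ne_eq, Finset.prod_ne_zero_iff] at hne
    obtain ⟨e, e', h⟩ := exists_sumCongr_of_mapsTo σ (fun a => by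
        rcases h : σ (Sum.inl a) with x | x
        · exact ⟨x, rfl⟩
        · exact absurd (h ▸ hlr a x) (hne (Sum.inl a) (Finset.mem_univ _))) (fun b => by
        rcases h : σ (Sum.inr b) with x | x
        · exact absurd (h ▸ hrl b x) (hne (Sum.inr b) (Finset.mem_univ _))
        · exact ⟨x, rfl⟩)
    exact hσ ⟨(e, e'), by simp, h⟩
  · rintro ⟨e, e'⟩ -
    simp [Fintype.prod_sum_type]

end Combinatorics

/-! ### Splitting Fock space along disjoint supports -/

section Split

variable {X : Type*} [MeasurableSpace X] {μ : Measure X}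

/-- `f` vanishes almost everywhere outside `s`. -/
def VanishesOff (s : Set X) (f : L2 μ) : Prop := ∀ᵐ k ∂μ, k ∉ s → f k = 0

lemma VanishesOff.mono {s t : Set X} {f : L2 μ} (hf : VanishesOff s f) (h : s ⊆ t) :
    VanishesOff t f := by
  filter_upwards [hf] with k hk hkt
  exact hk fun hks => hkt (h hks)

lemma inner_eq_zero_of_disjoint {s t : Set X} (h : Disjoint s t) {f g : L2 μ}
    (hf : VanishesOff s f) (hg : VanishesOff t g) : ⟪f, g⟫_ℂ = 0 := by
  rw [L2.inner_def]
  refine integral_eq_zero_of_ae ?_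
  filter_upwards [hf, hg] with k hf hg
  by_cases hk : k ∈ s
  · rw [hg (Set.disjoint_left.1 h hk)]; simp
  · rw [hf hk]; simp

lemma inner_restrict {s : Set X} {f g : L2 μ} (hf : VanishesOff s f) :
    ⟪LpToLpRestrictCLM X ℂ ℂ μ 2 s f, LpToLpRestrictCLM X ℂ ℂ μ 2 s g⟫_ℂ = ⟪f, g⟫_ℂ := by
  rw [L2.inner_def, L2.inner_def]
  rw [← setIntegral_eq_integral_of_ae_compl_eq_zero (s := s) (f := fun k => ⟪f k, g k⟫_ℂ)]
  · refine integral_congr_ae ?_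
    filter_upwards [LpToLpRestrictCLM_coeFn ℂ s f, LpToLpRestrictCLM_coeFn ℂ s g] with k h1 h2
    rw [h1, h2]
  · filter_upwards [hf] with k hk hks
    rw [hk hks]; simp

/-- The restriction of `f` to `s`, extended by zero. -/
def cutoff {s : Set X} (hs : MeasurableSet s) (f : L2 μ) : L2 μ :=
  ((Lp.memLp f).indicator hs).toLp _

lemma coeFn_cutoff {s : Set X} (hs : MeasurableSet s) (f : L2 μ) :
    cutoff hs f =ᵐ[μ] s.indicator f := MemLp.coeFn_toLp _

lemma vanishesOff_cutoff {s : Set X} (hs : MeasurableSet s) (f : L2 μ) :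
    VanishesOff s (cutoff hs f) := by
  filter_upwards [coeFn_cutoff hs f] with k hk hks
  rw [hk, Set.indicator_of_notMem hks]

lemma isTotal_vanishesOff {s t : Set X} (hs : MeasurableSet s) (ht : MeasurableSet t)
    (hd : Disjoint s t) (hc : ∀ᵐ k ∂μ, k ∈ s ∪ t) :
    IsTotal {f : L2 μ | VanishesOff s f ∨ VanishesOff t f} := by
  rw [isTotal_iff]
  intro K _ h f
  have : f = cutoff hs f + cutoff ht f := by
    refine Lp.ext ?_
    filter_upwards [coeFn_cutoff hs f, coeFn_cutoff ht f, Lp.coeFn_add (cutoff hs f) (cutoff ht f),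
      hc] with k h1 h2 h3 h4
    rw [h3, Pi.add_apply, h1, h2]
    rcases h4 with h4 | h4
    · rw [Set.indicator_of_mem h4, Set.indicator_of_notMem (Set.disjoint_left.1 hd h4), add_zero]
    · rw [Set.indicator_of_mem h4, Set.indicator_of_notMem (Set.disjoint_right.1 hd h4), zero_add]
  rw [this]
  exact K.add_mem (h (Or.inl (vanishesOff_cutoff hs f))) (h (Or.inr (vanishesOff_cutoff ht f)))

lemma isTotal_vanishesOff_iUnion {s : ℕ → Set X} (hs : ∀ k, MeasurableSet (s k))
    (hc : ∀ᵐ x ∂μ, ∃ k, x ∈ s k) :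
    IsTotal {f : L2 μ | ∃ k, VanishesOff (s k) f} := by
  rw [isTotal_iff]
  intro K hK h z
  have : CompleteSpace K := hK.completeSpace_coe
  rw [← K.orthogonal_orthogonal, mem_orthogonal]
  intro g hg
  suffices g = 0 by rw [this, inner_zero_left]
  have h0 : ∀ k, cutoff (hs k) g = 0 := fun k => by
    have h1 : ⟪cutoff (hs k) g, g⟫_ℂ = 0 :=
      (mem_orthogonal K g).1 hg _ (h ⟨k, vanishesOff_cutoff (hs k) g⟩)
    -- The cutoff of `g` is orthogonal to `g` and to the remainder `g - cutoff g`, hence to itself.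
    have h2 : ⟪cutoff (hs k) g, g - cutoff (hs k) g⟫_ℂ = 0 := by
      refine inner_eq_zero_of_disjoint disjoint_compl_right (vanishesOff_cutoff (hs k) g) ?_
      filter_upwards [coeFn_cutoff (hs k) g, Lp.coeFn_sub g (cutoff (hs k) g)] with x hx hx' hxs
      rw [hx', Pi.sub_apply, hx, Set.indicator_of_mem (not_not.1 hxs), sub_self]
    rw [inner_sub_right, h1, zero_sub, neg_eq_zero] at h2
    exact inner_self_eq_zero.1 h2
  refine (Lp.eq_zero_iff_ae_eq_zero).2 ?_
  have h1 : ∀ k, ∀ᵐ x ∂μ, (s k).indicator g x = 0 := fun k => by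
    filter_upwards [coeFn_cutoff (hs k) g, (Lp.eq_zero_iff_ae_eq_zero).1 (h0 k)] with x hx hx'
    rw [← hx, hx']; rfl
  filter_upwards [ae_all_iff.2 h1, hc] with x hx ⟨k, hk⟩
  rw [Pi.zero_apply, ← hx k, Set.indicator_of_mem hk]

variable [SigmaFinite μ] {s t : Set X}

lemma inner_fockVec_append (hd : Disjoint s t) {m n m' n' : ℕ}
    {f : Fin m → L2 μ} {g : Fin n → L2 μ} {f' : Fin m' → L2 μ} {g' : Fin n' → L2 μ}
    (hf : ∀ i, VanishesOff s (f i)) (hg : ∀ i, VanishesOff t (g i))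
    (hf' : ∀ i, VanishesOff s (f' i)) (hg' : ∀ i, VanishesOff t (g' i)) :
    ⟪fockVec (Fin.append f g), fockVec (Fin.append f' g')⟫_ℂ =
      ⟪fockVec f, fockVec f'⟫_ℂ * ⟪fockVec g, fockVec g'⟫_ℂ := by
  simp only [inner_fockVec]
  have := sum_equiv_prod_block (fun (i : Fin m ⊕ Fin n) (j : Fin m' ⊕ Fin n') =>
    ⟪Sum.elim f g i, Sum.elim f' g' j⟫_ℂ)
    (fun i j => inner_eq_zero_of_disjoint hd (hf i) (hg' j))
    (fun i j => inner_eq_zero_of_disjoint hd.symm (hg i) (hf' j))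
  simp only [Sum.elim_inl, Sum.elim_inr] at this
  rw [← this]
  refine (Fintype.sum_equiv (Equiv.equivCongr finSumFinEquiv finSumFinEquiv) _ _ fun σ => ?_).symm
  refine Fintype.prod_equiv finSumFinEquiv _ _ fun i => ?_
  have h1 : ∀ i, Fin.append f g (finSumFinEquiv i) = Sum.elim f g i := by
    rintro (i | i) <;> simp
  have h2 : ∀ i, Fin.append f' g' (finSumFinEquiv i) = Sum.elim f' g' i := by
    rintro (i | i) <;> simp
  simp [h1, h2, Equiv.equivCongr]

/-- Factors can be sorted by support, since a symmetric tensor ignores their order. -/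
lemma isTotal_fockVec_append (hs : MeasurableSet s) (ht : MeasurableSet t)
    (hd : Disjoint s t) (hc : ∀ᵐ k ∂μ, k ∈ s ∪ t) :
    IsTotal {z : Fock μ | ∃ (m n : ℕ) (f : Fin m → L2 μ) (g : Fin n → L2 μ),
      (∀ i, VanishesOff s (f i)) ∧ (∀ j, VanishesOff t (g j)) ∧
        z = fockVec (Fin.append f g)} := by
  rw [isTotal_iff]
  intro K hK h
  refine (isTotal_fockVec (isTotal_vanishesOff hs ht hd hc)).le_of_subset hK ?_
  rintro _ ⟨n, f, hf, rfl⟩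
  classical
  set S : Finset (Fin n) := Finset.univ.filter fun i => VanishesOff s (f i)
  let e := (finSumFinEquiv.symm.trans (finSumEquivOfFinset (s := S) rfl rfl))
  rw [← fockVec_comp_equiv e]
  refine h ⟨_, _, fun i => f (finSumEquivOfFinset (s := S) rfl rfl (Sum.inl i)),
    fun i => f (finSumEquivOfFinset (s := S) rfl rfl (Sum.inr i)), fun i => ?_, fun j => ?_, ?_⟩
  · have : finSumEquivOfFinset (s := S) rfl rfl (Sum.inl i) ∈ S := by
      rw [finSumEquivOfFinset_inl]; exact Finset.orderEmbOfFin_mem _ _ _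
    exact (Finset.mem_filter.1 this).2
  · have : finSumEquivOfFinset (s := S) rfl rfl (Sum.inr j) ∈ Sᶜ := by
      rw [finSumEquivOfFinset_inr]; exact Finset.orderEmbOfFin_mem _ _ _
    refine (hf _).resolve_left fun h => Finset.mem_compl.1 this ?_
    exact Finset.mem_filter.2 ⟨Finset.mem_univ _, h⟩
  · congr 1
    funext i
    refine Fin.addCases (fun i => ?_) (fun i => ?_) i <;> simp [e]

lemma exists_isometry_fockSplit (hs : MeasurableSet s) (ht : MeasurableSet t)
    (hd : Disjoint s t) (hc : ∀ᵐ k ∂μ, k ∈ s ∪ t) :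
    ∃ U : Fock μ →ₗᵢ[ℂ] HilbertTensor (Fock (μ.restrict s)) (Fock (μ.restrict t)),
      (∀ x y, (x, y) ∈ (fockSplit μ s t).graph ↔ U x = y) ∧
      ∀ (m n : ℕ) (f : Fin m → L2 μ) (g : Fin n → L2 μ),
        (∀ i, VanishesOff s (f i)) → (∀ j, VanishesOff t (g j)) →
        U (fockVec (Fin.append f g)) =
          elemTensor (fockVec fun i => LpToLpRestrictCLM X ℂ ℂ μ 2 s (f i))
            (fockVec fun j => LpToLpRestrictCLM X ℂ ℂ μ 2 t (g j)) := by
  obtain ⟨U, hU, hU'⟩ := exists_isometry_of_gram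
    {p : Fock μ × HilbertTensor (Fock (μ.restrict s)) (Fock (μ.restrict t)) |
      ∃ (m n : ℕ) (f : Fin m → L2 μ) (g : Fin n → L2 μ),
      (∀ i, ∀ᵐ k ∂μ, k ∉ s → f i k = 0) ∧ (∀ j, ∀ᵐ k ∂μ, k ∉ t → g j k = 0) ∧
      p = (fockVec (Fin.append f g),
        elemTensor (fockVec fun i => LpToLpRestrictCLM X ℂ ℂ μ 2 s (f i))
          (fockVec fun j => LpToLpRestrictCLM X ℂ ℂ μ 2 t (g j)))} (by
    rintro _ ⟨m, n, f, g, hf, hg, rfl⟩ _ ⟨m', n', f', g', hf', hg', rfl⟩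
    simp only
    rw [inner_fockVec_append hd hf hg hf' hg', inner_elemTensor]
    simp only [inner_fockVec, inner_restrict (hf _), inner_restrict (hg _)]) (by
    rw [isTotal_iff]
    refine fun K hK h => (isTotal_fockVec_append hs ht hd hc).le_of_subset hK ?_
    rintro _ ⟨m, n, f, g, hf, hg, rfl⟩
    exact h ⟨_, ⟨m, n, f, g, hf, hg, rfl⟩, rfl⟩)
  exact ⟨U, hU, fun m n f g hf hg => hU' _ ⟨m, n, f, g, hf, hg, rfl⟩⟩

end Split

/-! ### Joint eigenvectors of the two number operators -/

section SplitNumber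

variable {X : Type*} [MeasurableSpace X] {μ : Measure X} [SigmaFinite μ] {s t : Set X}
variable (H : Type*) [NormedAddCommGroup H] [InnerProductSpace ℂ H]

lemma exists_resolution_split (hs : MeasurableSet s) (ht : MeasurableSet t) (hd : Disjoint s t)
    (hc : ∀ᵐ k ∂μ, k ∈ s ∪ t)
    {P : ℕ → HilbertTensor H (Fock μ) →L[ℂ] HilbertTensor H (Fock μ)}
    (hP : ∀ n (x : H) y, P n (elemTensor x y) = elemTensor x (particleProj μ n y)) :
    ∃ Q : ℕ → HilbertTensor H (Fock μ) →L[ℂ] HilbertTensor H (Fock μ), IsResolution Q ∧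
      IsDiag (conjBy (idTensor H (fockSplit μ s t))
        (idTensor H (idTensor (Fock (μ.restrict s)) (fockNumber (μ.restrict t)))))
        Q (fun n => (n : ℝ)) ∧
      IsTotal {z : HilbertTensor H (Fock μ) | ∃ k m, k ≤ m ∧
        (∀ n, P n z = if n = m then z else 0) ∧ ∀ n, Q n z = if n = k then z else 0} ∧
      ∀ n, ∀ z ∈ {z : HilbertTensor H (Fock μ) | ∃ (x : H) (g : Fin n → L2 μ),
        (∀ j, VanishesOff t (g j)) ∧ z = elemTensor x (fockVec g)}, Q n z = z := by
  obtain ⟨U, hU, hUv⟩ := exists_isometry_fockSplit hs ht hd hc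
  have hT := isTotal_fockVec_append hs ht hd hc
  obtain ⟨Q, hQ, hQd, hQv⟩ := exists_resolution_conjBy_idTensor H hU
    (isResolution_particleProj (μ.restrict t)) (isDiag_fockNumber (μ.restrict t)) hT (by
      rintro _ ⟨m, n, f, g, hf, hg, rfl⟩
      exact ⟨n, _, _, hUv m n f g hf hg, fun k => particleProj_fockVec k _⟩)
  have hQe : ∀ (x : H) (m n : ℕ) (f : Fin m → L2 μ) (g : Fin n → L2 μ),
      (∀ i, VanishesOff s (f i)) → (∀ j, VanishesOff t (g j)) → ∀ k,
      Q k (elemTensor x (fockVec (Fin.append f g))) =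
        if k = n then elemTensor x (fockVec (Fin.append f g)) else 0 :=
    fun x m n f g hf hg => hQv x _ n _ _ (hUv m n f g hf hg) fun k => particleProj_fockVec k _
  refine ⟨Q, hQ, hQd, ?_, ?_⟩
  · rw [isTotal_iff]
    refine fun K hK h => (hT.elemTensor (E := H)).le_of_subset hK ?_
    rintro _ ⟨x, _, ⟨m, n, f, g, hf, hg, rfl⟩, rfl⟩
    refine h ⟨n, m + n, Nat.le_add_left n m, fun k => ?_, hQe x m n f g hf hg⟩
    rw [hP, particleProj_fockVec]
    split_ifs
    · rfl
    · rw [← elemTensorL_apply, map_zero]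
  · rintro n _ ⟨x, g, hg, rfl⟩
    -- With no factor supported in `s`, every particle is counted; `0 + n` is then identified with
    -- `n`.
    have := hQe x 0 n Fin.elim0 g (fun i => i.elim0) hg n
    have e : fockVec (Fin.append Fin.elim0 g) = fockVec g := by
      rw [Fin.elim0_append]
      exact fockVec_comp_equiv (finCongr (Nat.zero_add n)) g
    rwa [e, if_pos rfl] at this

end SplitNumber

/-! ### Momentum space and the infrared limit -/

section Final

variable {d : ℕ}

lemma measurableSet_inner_set (ε : ℝ) : MeasurableSet (inner_set d ε) :=
  measurableSet_lt measurable_norm measurable_const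

lemma measurableSet_outer_set (ε : ℝ) : MeasurableSet (outer_set d ε) :=
  measurableSet_lt measurable_const measurable_norm

lemma disjoint_inner_outer (ε : ℝ) : Disjoint (inner_set d ε) (outer_set d ε) :=
  Set.disjoint_left.2 fun k (h : ‖k‖ < ε) (h' : ε < ‖k‖) => lt_asymm h h'

lemma ae_mem_inner_union_outer {ε : ℝ} (hε : 0 < ε) :
    ∀ᵐ k ∂(leb d), k ∈ inner_set d ε ∪ outer_set d ε := by
  have h := Measure.addHaar_sphere_of_ne_zero (leb d) 0 hε.ne'
  filter_upwards [measure_eq_zero_iff_ae_notMem.1 h] with k hk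
  rw [mem_sphere_zero_iff_norm] at hk
  exact lt_or_gt_of_ne hk

/-- Here `1 ≤ d` enters: the origin must be a null set, which fails in dimension zero. -/
lemma isTotal_vanishesOff_outer (hd : 1 ≤ d) :
    IsTotal {f : L2 (leb d) | ∃ k : ℕ, VanishesOff (outer_set d (1 / (k + 1 : ℝ))) f} := by
  have : Nonempty (Fin d) := ⟨⟨0, hd⟩⟩
  refine isTotal_vanishesOff_iUnion (fun k => measurableSet_outer_set _) ?_
  filter_upwards [measure_eq_zero_iff_ae_notMem.1
    (measure_singleton (μ := leb d) (0 : EuclideanSpace ℝ (Fin d)))] with x hx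
  exact exists_nat_one_div_lt (norm_pos_iff.2 hx)

variable (H : Type*) [NormedAddCommGroup H] [InnerProductSpace ℂ H]

lemma isTotal_eventually_vanishesOff_outer (hd : 1 ≤ d)
    {P : ℕ → StateSpace H d →L[ℂ] StateSpace H d}
    (hP : ∀ n (x : H) y, P n (elemTensor x y) = elemTensor x (particleProj (leb d) n y)) :
    IsTotal {z : StateSpace H d | ∃ m, (∀ n, P n z = if n = m then z else 0) ∧
      ∀ᶠ k : ℕ in atTop, z ∈ {z : StateSpace H d | ∃ (x : H) (g : Fin m → L2 (leb d)),
        (∀ j, VanishesOff (outer_set d (1 / (k + 1 : ℝ))) (g j)) ∧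
          z = elemTensor x (fockVec g)}} := by
  rw [isTotal_iff]
  refine fun K hK h => ((isTotal_fockVec (isTotal_vanishesOff_outer hd)).elemTensor
    (E := H)).le_of_subset hK ?_
  rintro _ ⟨x, _, ⟨n, f, hf, rfl⟩, rfl⟩
  refine h ⟨n, fun m => ?_, ?_⟩
  · rw [hP, particleProj_fockVec]
    split_ifs
    · rfl
    · rw [← elemTensorL_apply, map_zero]
  · choose k hk using hf
    -- There are finitely many factors, so the largest of their thresholds serves for all of them.
    filter_upwards [eventually_ge_atTop (Finset.univ.sup k)] with l hl
    refine ⟨x, f, fun j => (hk j).mono fun p hp => ?_, rfl⟩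
    have hp : 1 / ((k j : ℝ) + 1) < ‖p‖ := hp
    change 1 / ((l : ℝ) + 1) < ‖p‖
    refine lt_of_le_of_lt ?_ hp
    have : k j ≤ l := (Finset.le_sup (Finset.mem_univ j)).trans hl
    gcongr

/-- `D_CNB` is the form domain of the number operator `N`, and `‖N_{>ε}^{1/2} Ψ‖²` has supremum
`‖N^{1/2} Ψ‖²`. -/
theorem domainCNB_eq_and_isLUB (hd : 1 ≤ d) :
    domainCNB H d = ((opSqrt (number H d)).domain : Set (StateSpace H d)) ∧
      ∀ Ψ : StateSpace H d, Ψ ∈ domainCNB H d →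
        ∃ (h : ∀ ε : ℝ, 0 < ε → Ψ ∈ (opSqrt (numberGT H d ε)).domain)
          (h₀ : Ψ ∈ (opSqrt (number H d)).domain),
          IsLUB (Set.range fun ε : Set.Ioi (0 : ℝ) => ‖opSqrt (numberGT H d ε) ⟨Ψ, h ε ε.2⟩‖ ^ 2)
            (‖opSqrt (number H d) ⟨Ψ, h₀⟩‖ ^ 2) := by
  have hN := isResolution_particleProj (leb d)
  obtain ⟨P, hP, hPv⟩ := hN.exists_tensor (E := H)
  have hA : IsDiag (number H d) P fun n => (n : ℝ) :=
    (isDiag_fockNumber (leb d)).idTensor hN hP hPv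
  have h := isLUB_opSqrt_of_exists (B := numberGT H d) hP hA
    (fun ε hε => exists_resolution_split H (measurableSet_inner_set ε) (measurableSet_outer_set ε)
      (disjoint_inner_outer ε) (ae_mem_inner_union_outer hε) hPv)
    (isTotal_eventually_vanishesOff_outer H hd hPv)
  exact ⟨h.1, fun Ψ hΨ => h.2 Ψ (h.1.le hΨ)⟩

end Final

end FockNumber

end

theorem mainTheorem12 (H : Type*) [NormedAddCommGroup H] [InnerProductSpace ℂ H]
    [CompleteSpace H] [TopologicalSpace.SeparableSpace H] (d : ℕ) (hd : 1 ≤ d) :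
    FockNumber.domainCNB H d =
        ((FockNumber.opSqrt (FockNumber.number H d)).domain :
          Set (FockNumber.StateSpace H d)) ∧
      ∀ Ψ : FockNumber.StateSpace H d, Ψ ∈ FockNumber.domainCNB H d →
        ∃ (h : ∀ ε : ℝ, 0 < ε → Ψ ∈ (FockNumber.opSqrt (FockNumber.numberGT H d ε)).domain)
          (h₀ : Ψ ∈ (FockNumber.opSqrt (FockNumber.number H d)).domain),
          IsLUB
            (Set.range fun ε : Set.Ioi (0 : ℝ) =>
              ‖FockNumber.opSqrt (FockNumber.numberGT H d ε) ⟨Ψ, h ε ε.2⟩‖ ^ 2)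
            (‖FockNumber.opSqrt (FockNumber.number H d) ⟨Ψ, h₀⟩‖ ^ 2) :=
  FockNumber.domainCNB_eq_and_isLUB H hd
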